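/- Let $d\ge 1$ and $\lambda>0$, and let $\mathcal P$ and $\mathcal P'$ be independent Poisson processes in $\mathbb R^d$ of intensities $1$ and $\lambda$ respectively. The directed secrecy graph has vertex set $\mathcal P$, with a directed edge from $x\in\mathcal P$ to $y\in\mathcal P$, $y\neq x$, if there is no point of $\mathcal P'$ in the open ball with centre $x$ and radius $\|x-y\|$. Let $V_d$ be the volume of a randomly chosen (typical) cell of the Voronoi tessellation associated with a unit intensity Poisson process in $\mathbb R^d$. (Distributions, probabilities and expectations for a randomly chosen vertex or cell are understood in the Palm sense: for any Borel window $W$ with $0<|W|<\infty$, the expectation of a quantity over a typical point of a point process is the expected sum of that quantity over the points of the process in $W$, divided by the expected number of points in $W$.) Almost surely, all degrees in the secrecy graph and all volumes of the cells are finite. The outdegree of a typical vertex is geometric with mean $1/\lambda$, that is, it equals $k$ with probability $\left(\frac{1}{1+\lambda}\right)^k\frac{\lambda}{1+\lambda}$ for $k=0,1,2,\dots$. The indegree $I$ of a typical vertex has moment generating function \[ \mathbb E(e^{tI})=\mathbb E\left(e^{V_d(e^t-1)/\lambda}\right)\qquad(t\in\mathbb R), \] as an identity in $[0,\infty]$.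 Equivalently, for $k=0,1,2,\dots$, \[ \mathbb P(I=k)=\frac1{k!}\,\mathbb E\left(e^{-V_d/\lambda}(V_d/\lambda)^k\right); \] that is, if $f_d$ is the probability density function of $V_d$, then \[ \mathbb P(I=k)=\frac{1}{k!}\int_0^{\infty}f_d(s)\,e^{-s/\lambda}(s/\lambda)^k\,ds . \] -/

import Mathlib

open MeasureTheory ProbabilityTheory
open scoped ENNReal NNReal

noncomputable section

/-- Euclidean space `ℝ^d` (Euclidean norm, Lebesgue measure). -/
abbrev Space (d : ℕ) : Type := EuclideanSpace ℝ (Fin d)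

/-- The number of points of the random set `X` in `B`. -/
def pointCount {d : ℕ} {Ω : Type*} (X : Ω → Set (Space d)) (B : Set (Space d)) (ω : Ω) : ℕ∞ :=
  (X ω ∩ B).encard

/-- `X` is a homogeneous Poisson (point) process of intensity `c` in `ℝ^d`: the number of points in
a Borel set of finite volume `v` is Poisson distributed with mean `c * v`, and the numbers of points
in disjoint Borel sets are independent. (In particular `X` is almost surely locally finite.) -/
structure IsPoissonProcess {d : ℕ} {Ω : Type*} [MeasurableSpace Ω] (μ : Measure Ω)
    (X : Ω → Set (Space d)) (c : ℝ≥0) : Prop where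
  measurable_count : ∀ B : Set (Space d), MeasurableSet B → Measurable (pointCount X B)
  law_count : ∀ B : Set (Space d), MeasurableSet B → volume B ≠ ∞ → ∀ n : ℕ,
    μ {ω | pointCount X B ω = n} = poissonMeasure (c * (volume B).toNNReal) {n}
  indep_count : ∀ (n : ℕ) (B : Fin n → Set (Space d)), (∀ i, MeasurableSet (B i)) →
    Pairwise (Function.onFun Disjoint B) → iIndepFun (fun i => pointCount X (B i)) μ

/-- The σ-algebra on `Ω` generated by the point counts of `X` in Borel sets. -/
@[reducible]
def processSigma {d : ℕ} {Ω : Type*} (X : Ω → Set (Space d)) : MeasurableSpace Ω :=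
  ⨆ B : {B : Set (Space d) // MeasurableSet B}, MeasurableSpace.comap (pointCount X B) ⊤

/-- Independence of two random point sets. -/
def IndepProcesses {d : ℕ} {Ω : Type*} [MeasurableSpace Ω] (μ : Measure Ω)
    (X Y : Ω → Set (Space d)) : Prop :=
  Indep (processSigma X) (processSigma Y) μ

/-- The mean of the quantity `f ω x` over a typical (randomly chosen) point `x` of `X ω`, with
values in `[0, ∞]`: the expected sum of `f` over the points of `X` in the observation window `W`,
divided by the expected number of points of `X` in `W`. -/
def typicalMean {d : ℕ} {Ω : Type*} [MeasurableSpace Ω] (μ : Measure Ω)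
    (X : Ω → Set (Space d)) (W : Set (Space d)) (f : Ω → Space d → ℝ≥0∞) : ℝ≥0∞ :=
  (∫⁻ ω, ∑' x : ↥(X ω ∩ W), f ω x ∂μ) / ∫⁻ ω, (pointCount X W ω : ℝ≥0∞) ∂μ

open Classical in
/-- The probability that a typical point `x` of `X ω` has the property `p ω x`. -/
def typicalProb {d : ℕ} {Ω : Type*} [MeasurableSpace Ω] (μ : Measure Ω)
    (X : Ω → Set (Space d)) (W : Set (Space d)) (p : Ω → Space d → Prop) : ℝ≥0∞ :=
  typicalMean μ X W (fun ω x => if p ω x then 1 else 0)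

/-- The directed secrecy graph with black points `P` and red points `R`. Only the points of `P` are
vertices: all other points of the space are isolated. There are no loops. -/
def secrecyGraph {d : ℕ} (P R : Set (Space d)) : Digraph (Space d) where
  Adj x y := x ∈ P ∧ y ∈ P ∧ x ≠ y ∧ ∀ z ∈ R, z ∉ Metric.ball x ‖x - y‖

/-- The set of out-neighbours of `x` in a digraph. -/
def outNeighbours {V : Type*} (G : Digraph V) (x : V) : Set V := {y | G.Adj x y}

/-- The set of in-neighbours of `x` in a digraph. -/
def inNeighbours {V : Type*} (G : Digraph V) (x : V) : Set V := {y | G.Adj y x}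

/-- The cell of `x` in the Voronoi tessellation associated with the point set `Q`. -/
def voronoiCell {d : ℕ} (Q : Set (Space d)) (x : Space d) : Set (Space d) :=
  {z | ∀ y ∈ Q, ‖z - x‖ ≤ ‖z - y‖}

/-- The volume of the Voronoi cell of `x`, as a real number. -/
def cellVolume {d : ℕ} (Q : Set (Space d)) (x : Space d) : ℝ := volume.real (voronoiCell Q x)

end

/-! The out- and in-neighbours of a black point `x` are the black points other than `x` in a region
fixed by the red points, namely `voidRegion`: the points `y` for which the open ball of radius `‖x -
y‖` about `x` (out) or about `y` (in) contains no red point. By the Mecke equation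
(`IsPoissonLaw.mecke`, and `IsPoissonProcess.typicalMean_eq` for typical points), a typical point of
a Poisson process sees the same process with one extra point placed at a fixed position. Given the
red points, the degree of a typical vertex is therefore Poisson with mean the volume of its region.
Each degree law is a mixed Poisson law, and only the law of that volume is needed.

The out-region is a ball reaching to the nearest red point. Void probabilities make its volume
exponential with rate `lam` (`IsPoissonLaw.tail_voidRegion`), and an exponential mixture of Poisson
laws is geometric.

The in-region is the Voronoi cell of `x` among the red points (`voronoiCell_eq`). The Mecke equation
for `Q` identifies the typical cell with the same region for a unit intensity process, and scaling
lengths by `lam ^ (-1/d)` shows that the in-region has the law of `V_d / lam`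
(`lintegral_voidRegion_intensity`).

Finiteness follows because the void probability of a ball depends only on its radius: by Fubini both
regions have mean volume `1 / lam`.

The Mecke equation itself rests on `E[N f(N)] = a E[f(N + 1)]` for a Poisson variable `N` of mean
`a`, applied to the counts in the cells of a finite partition. -/

/-! ### Poisson random measures: uniqueness in law and the Mecke equation for a fixed set -/

section Poisson

variable {E : Type*} [MeasurableSpace E]

/-- The Poisson distribution with mean `a`, as a measure on `[0, ∞]`. -/
noncomputable def poissonENN (a : ℝ≥0∞) : Measure ℝ≥0∞ :=
  (poissonMeasure a.toNNReal).map (fun n : ℕ => (n : ℝ≥0∞))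

instance (a : ℝ≥0∞) : IsProbabilityMeasure (poissonENN a) :=
  Measure.isProbabilityMeasure_map Measurable.of_discrete.aemeasurable

/-- The law `ρ` of a random measure is that of a Poisson random measure with intensity measure
`Λ`. -/
structure IsPoissonLaw (ρ : Measure (Measure E)) (Λ : Measure E) : Prop where
  prob : IsProbabilityMeasure ρ
  map_count : ∀ (n : ℕ) (D : Fin n → Set E), (∀ i, MeasurableSet (D i)) →
    Pairwise (Function.onFun Disjoint D) → (∀ i, Λ (D i) ≠ ∞) →
    ρ.map (fun m i => m (D i)) = Measure.pi fun i => poissonENN (Λ (D i))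

lemma measurable_counts {ι : Type*} {D : ι → Set E} (hD : ∀ i, MeasurableSet (D i)) :
    Measurable fun (m : Measure E) i => m (D i) :=
  measurable_pi_lambda _ fun i => Measure.measurable_coe (hD i)

/-- A finite family of measurable sets is generated by a finite measurable partition. -/
lemma exists_partition {ι : Type*} [Finite ι] (B : ι → Set E) (hB : ∀ i, MeasurableSet (B i)) :
    ∃ (n : ℕ) (D : Fin n → Set E) (S : ι → Finset (Fin n)), (∀ j, MeasurableSet (D j)) ∧
      Pairwise (Function.onFun Disjoint D) ∧ (∀ i, B i = ⋃ j ∈ S i, D j) ∧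
      ∀ j, D j ⊆ ⋃ i, B i := by
  classical
  have := Fintype.ofFinite ι
  let e := (Fintype.equivFin (Set ι)).symm
  -- The cells are the atoms of the generated algebra: points are grouped by the set of indices `i`
  -- with `x ∈ B i`. Cutting with the union discards the one atom that may have infinite measure.
  refine ⟨_, fun j => (⋃ i, B i) ∩ {x | ∀ i, x ∈ B i ↔ i ∈ e j},
    fun i => Finset.univ.filter fun j => i ∈ e j, ?_, ?_, ?_, ?_⟩
  · intro j
    refine (MeasurableSet.iUnion hB).inter ?_
    rw [Set.ofPred_forall]
    refine MeasurableSet.iInter fun i => ?_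
    by_cases h : i ∈ e j
    · simpa [h] using hB i
    · simp only [h, iff_false]
      exact (hB i).compl
  · intro j k hjk
    refine Set.disjoint_left.2 fun x hx hy => hjk (e.injective (Set.ext fun i => ?_))
    exact (hx.2 i).symm.trans (hy.2 i)
  · intro i
    ext x
    simp only [Finset.mem_filter, Finset.mem_univ, true_and, Set.mem_iUnion, exists_prop,
      Set.mem_inter_iff, Set.mem_ofPred_eq]
    constructor
    · intro hx
      refine ⟨e.symm {i | x ∈ B i}, ?_, ⟨i, hx⟩, ?_⟩ <;> simp [hx]
    · rintro ⟨j, hj, -, h⟩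
      exact (h i).2 hj
  · exact fun j => Set.inter_subset_left

/-- Finite measures on the space of measures are determined by the joint laws of the masses of
disjoint sets of finite `Λ`-measure, fine enough to generate a given set `A`. -/
lemma ext_of_map_counts {ρ ρ' : Measure (Measure E)} [IsFiniteMeasure ρ] (Λ : Measure E)
    [SigmaFinite Λ] {A : Set E} (hA : MeasurableSet A) (hA' : Λ A ≠ ∞)
    (h : ∀ (n : ℕ) (D : Fin n → Set E) (S : Finset (Fin n)), (∀ i, MeasurableSet (D i)) →
      Pairwise (Function.onFun Disjoint D) → (∀ i, Λ (D i) ≠ ∞) → A = ⋃ j ∈ S, D j →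
      ρ.map (fun m i => m (D i)) = ρ'.map (fun m i => m (D i))) : ρ = ρ' := by
  let m₀ : {B : Set E // MeasurableSet B ∧ Λ B ≠ ∞} → MeasurableSpace (Measure E) :=
    fun B => MeasurableSpace.comap (fun m => m B) inferInstance
  have key : ∀ (t : Finset {B : Set E // MeasurableSet B ∧ Λ B ≠ ∞}) (C : t → Set ℝ≥0∞),
      (∀ i, MeasurableSet (C i)) →
      ρ {m | ∀ i : t, m i.1 ∈ C i} = ρ' {m | ∀ i : t, m i.1 ∈ C i} := by
    intro t C hC
    -- `A` joins the family under the index `none`, so that the partition also generates `A`, as `h`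
    -- demands.
    obtain ⟨n, D, S, hD, hdis, hS, hsub⟩ := exists_partition
      (fun i : Option t => i.elim A fun i => (i.1 : Set E))
      (by rintro (_ | i); exacts [hA, i.1.2.1])
    have hfin : ∀ j, Λ (D j) ≠ ∞ := by
      intro j
      refine ne_top_of_le_ne_top ?_ ((measure_mono (hsub j)).trans (measure_iUnion_le _))
      rw [tsum_fintype]
      refine (ENNReal.sum_lt_top.2 ?_).ne
      rintro (_ | i) -
      exacts [hA'.lt_top, i.1.2.2.lt_top]
    have hm := h n D (S none) hD hdis hfin (hS none)
    have heq : {m : Measure E | ∀ i : t, m i.1 ∈ C i} = (fun m i => m (D i)) ⁻¹'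
        {v : Fin n → ℝ≥0∞ | ∀ i : t, ∑ j ∈ S (some i), v j ∈ C i} := by
      ext m
      refine forall_congr' fun i => ?_
      have := hS (some i)
      simp only [Option.elim] at this
      rw [this, measure_biUnion_finset (fun a _ b _ hab => hdis hab) fun j _ => hD j]
    have hmeas : MeasurableSet {v : Fin n → ℝ≥0∞ | ∀ i : t, ∑ j ∈ S (some i), v j ∈ C i} := by
      rw [Set.ofPred_forall]
      refine MeasurableSet.iInter fun i => ?_
      exact (Finset.measurable_sum _ fun j _ => measurable_pi_apply j) (hC i)
    rw [heq, ← Measure.map_apply (measurable_counts hD) hmeas, hm,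
      Measure.map_apply (measurable_counts hD) hmeas]
  have hpi : ∀ s ∈ piiUnionInter (fun B => {s | MeasurableSet[m₀ B] s}) Set.univ,
      ρ s = ρ' s := by
    rintro s ⟨t, -, f, hf, rfl⟩
    have hf' : ∀ i : t, ∃ C : Set ℝ≥0∞, MeasurableSet C ∧ (fun m : Measure E => m i.1) ⁻¹' C = f i :=
      fun i => hf i i.2
    choose C hC hCf using hf'
    convert key t C hC using 2 <;>
    · ext m
      rw [Set.mem_iInter₂]
      constructor
      · intro hm i
        have := hm i i.2
        rwa [← hCf i] at this
      · intro hm i hi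
        rw [← hCf ⟨i, hi⟩]
        exact hm ⟨i, hi⟩
  refine ext_of_generate_finite _ ?_ (isPiSystem_piiUnionInter _
    (fun B => (m₀ B).isPiSystem_measurableSet) _) hpi ?_
  · refine Eq.trans ?_ (generateFrom_piiUnionInter_measurableSet m₀ Set.univ).symm
    simp only [Set.mem_univ, iSup_pos]
    refine le_antisymm ?_ ?_
    · refine iSup₂_le fun B hB => ?_
      rw [← measurable_iff_comap_le]
      -- Sets of infinite `Λ`-measure add nothing to the σ-algebra, since their masses are limits
      -- along the spanning sets.
      have hlim : (fun m : Measure E => m B) = fun m => ⨆ n, m (B ∩ spanningSets Λ n) := by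
        funext m
        rw [← Monotone.measure_iUnion, ← Set.inter_iUnion, iUnion_spanningSets, Set.inter_univ]
        exact fun i j hij => Set.inter_subset_inter_right _ (monotone_spanningSets Λ hij)
      rw [hlim]
      refine Measurable.iSup fun n => ?_
      rw [measurable_iff_comap_le]
      exact le_iSup m₀ ⟨B ∩ spanningSets Λ n, hB.inter (measurableSet_spanningSets Λ n),
        ((measure_mono Set.inter_subset_right).trans_lt (measure_spanningSets_lt_top Λ n)).ne⟩
    · refine iSup_le fun B => ?_
      exact measurable_iff_comap_le.1 (Measure.measurable_coe B.2.1)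
  · simpa using key ∅ (fun _ => Set.univ) (fun _ => MeasurableSet.univ)

/-- The law of a Poisson random measure is determined by its intensity measure. -/
lemma IsPoissonLaw.unique {ρ ρ' : Measure (Measure E)} {Λ : Measure E} [SigmaFinite Λ]
    (h : IsPoissonLaw ρ Λ) (h' : IsPoissonLaw ρ' Λ) : ρ = ρ' := by
  have := h.prob
  refine ext_of_map_counts Λ MeasurableSet.empty (by simp) fun n D S hD hdis hfin _ => ?_
  rw [h.map_count n D hD hdis hfin, h'.map_count n D hD hdis hfin]

/-- Images of Poisson random measures are Poisson random measures. -/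
lemma IsPoissonLaw.map {F : Type*} [MeasurableSpace F] {ρ : Measure (Measure E)} {Λ : Measure E}
    (h : IsPoissonLaw ρ Λ) {T : E → F} (hT : Measurable T) :
    IsPoissonLaw (ρ.map (Measure.map T)) (Λ.map T) := by
  have := h.prob
  have hT' := Measure.measurable_map T hT
  refine ⟨Measure.isProbabilityMeasure_map hT'.aemeasurable, fun n D hD hdis hfin => ?_⟩
  rw [Measure.map_map (measurable_counts hD) hT']
  have := h.map_count n (fun i => T ⁻¹' D i) (fun i => hT (hD i))
    (fun i j hij => (hdis hij).preimage T) fun i => by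
      rw [← Measure.map_apply hT (hD i)]; exact hfin i
  simpa [Function.comp_def, Measure.map_apply hT, hD] using this

lemma lintegral_poissonENN (a : ℝ≥0∞) {f : ℝ≥0∞ → ℝ≥0∞} (hf : Measurable f) :
    ∫⁻ x, f x ∂poissonENN a =
      ∑' n : ℕ, ENNReal.ofReal (Real.exp (-a.toReal) * a.toReal ^ n / n.factorial) * f n := by
  rw [poissonENN, lintegral_map hf Measurable.of_discrete, lintegral_countable']
  refine tsum_congr fun n => ?_
  rw [poissonMeasure_singleton, mul_comm]
  rfl

/-- The factor `n` cancels against `n!` in the Poisson weight, and the index shifts by one.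
Finiteness matters: `poissonENN ∞` is by default the point mass at `0`. -/
lemma lintegral_poissonENN_mul {a : ℝ≥0∞} (ha : a ≠ ∞) {f : ℝ≥0∞ → ℝ≥0∞} (hf : Measurable f) :
    ∫⁻ x, x * f x ∂poissonENN a = a * ∫⁻ x, f (x + 1) ∂poissonENN a := by
  rw [lintegral_poissonENN a (by fun_prop), lintegral_poissonENN a (by fun_prop),
    tsum_eq_zero_add' ENNReal.summable, ← ENNReal.tsum_mul_left]
  simp only [Nat.cast_zero, zero_mul, mul_zero, zero_add]
  refine tsum_congr fun n => ?_
  rw [← mul_assoc, ← mul_assoc, Nat.cast_add, Nat.cast_one]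
  congr 1
  have h1 : ((n : ℝ≥0∞) + 1) = ENNReal.ofReal (n + 1) := by
    rw [ENNReal.ofReal_add (by positivity) zero_le_one]; simp
  rw [h1, ← ENNReal.ofReal_mul (by positivity)]
  nth_rw 3 [← ENNReal.ofReal_toReal ha]
  rw [← ENNReal.ofReal_mul (by positivity)]
  congr 1
  rw [Nat.factorial_succ]
  push_cast
  have : (n.factorial : ℝ) ≠ 0 := by positivity
  field_simp
  ring

/-- Fubini isolates the coordinate `k`, where the one-dimensional identity applies. This is the
Mecke equation for a vector of independent counts. -/
lemma lintegral_pi_poissonENN_mul {n : ℕ} {a : Fin n → ℝ≥0∞} (k : Fin n) (ha : a k ≠ ∞)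
    {H : (Fin n → ℝ≥0∞) → ℝ≥0∞} (hH : Measurable H) :
    ∫⁻ v, v k * H v ∂Measure.pi (fun i => poissonENN (a i)) =
      a k * ∫⁻ v, H (v + Pi.single k 1) ∂Measure.pi fun i => poissonENN (a i) := by
  obtain _ | n := n
  · exact k.elim0
  have hp := (measurePreserving_piFinSuccAbove (fun i => poissonENN (a i)) k).symm
  rw [← hp.lintegral_comp (by fun_prop), ← hp.lintegral_comp (by fun_prop),
    lintegral_prod_symm' _ (by fun_prop), lintegral_prod_symm' _ (by fun_prop),
    ← lintegral_const_mul _ (by fun_prop)]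
  refine lintegral_congr fun w => ?_
  have e1 : ∀ x, (MeasurableEquiv.piFinSuccAbove (fun _ => ℝ≥0∞) k).symm (x, w) =
      k.insertNth x w := fun x => rfl
  simp only [e1, Fin.insertNth_apply_same]
  have hH' : Measurable fun x => H (k.insertNth x w) := by
    have : Measurable fun x => (MeasurableEquiv.piFinSuccAbove (fun _ => ℝ≥0∞) k).symm (x, w) := by
      fun_prop
    exact hH.comp this
  rw [lintegral_poissonENN_mul ha hH']
  congr 1
  refine lintegral_congr fun x => ?_
  congr 1
  rw [show (Pi.single k 1 : Fin (n + 1) → ℝ≥0∞) = k.insertNth 1 0 by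
    rw [Fin.insertNth_zero_right], ← Fin.insertNth_add, add_zero]

lemma measurable_add_dirac :
    Measurable fun p : Measure E × E => p.1 + Measure.dirac p.2 :=
  measurable_fst.add (Measure.measurable_dirac.comp measurable_snd)

/-- The Mecke equation for a fixed set of points. -/
lemma IsPoissonLaw.withDensity_count {ρ : Measure (Measure E)} {Λ : Measure E} [SigmaFinite Λ]
    (h : IsPoissonLaw ρ Λ) {A : Set E} (hA : MeasurableSet A) (hA' : Λ A ≠ ∞) :
    ρ.withDensity (fun m => m A) =
      (ρ.prod (Λ.restrict A)).map fun p => p.1 + Measure.dirac p.2 := by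
  have := h.prob
  have : IsFiniteMeasure (Λ.restrict A) := ⟨by simpa using hA'.lt_top⟩
  symm
  refine ext_of_map_counts Λ hA hA' fun n D S hD hdis hfin hS => ?_
  have hN := measurable_counts hD
  ext T hT
  rw [Measure.map_map hN measurable_add_dirac, Measure.map_apply
    (hN.comp measurable_add_dirac) hT, Measure.prod_apply_symm
    ((hN.comp measurable_add_dirac) hT), Measure.map_apply hN hT, withDensity_apply _ (hN hT)]
  have hT1 : Measurable (T.indicator (fun _ => (1 : ℝ≥0∞))) := measurable_const.indicator hT
  have hAm : ∀ m : Measure E, m A = ∑ j ∈ S, m (D j) := fun m => by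
    rw [hS, measure_biUnion_finset (fun a _ b _ hab => hdis hab) fun j _ => hD j]
  -- `A` is a union of cells, so `m A` is a sum of coordinates of the count vector, and weighting by
  -- a coordinate shifts it by one.
  have hR : ∫⁻ m in (fun m i => m (D i)) ⁻¹' T, m A ∂ρ =
      ∑ j ∈ S, Λ (D j) * ρ {m | (fun i => m (D i)) + Pi.single j 1 ∈ T} := by
    rw [← lintegral_indicator (hN hT)]
    have : ∀ m : Measure E, ((fun m i => m (D i)) ⁻¹' T).indicator (fun m => m A) m =
        ∑ j ∈ S, m (D j) * T.indicator (fun _ => 1) (fun i => m (D i)) := by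
      intro m
      rw [← Finset.sum_mul, ← hAm]
      by_cases hm : (fun i => m (D i)) ∈ T
      · rw [Set.indicator_of_mem (by exact hm), Set.indicator_of_mem hm, mul_one]
      · rw [Set.indicator_of_notMem (by exact hm), Set.indicator_of_notMem hm, mul_zero]
    simp_rw [this]
    rw [lintegral_finsetSum]
    swap
    · exact fun j _ => (Measure.measurable_coe (hD j)).mul (hT1.comp hN)
    refine Finset.sum_congr rfl fun j _ => ?_
    have e1 := lintegral_map (μ := ρ) (f := fun v : Fin n → ℝ≥0∞ =>
      v j * T.indicator (fun _ => 1) v) (by fun_prop) hN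
    rw [← e1, h.map_count n D hD hdis hfin, lintegral_pi_poissonENN_mul j (hfin j) hT1,
      ← h.map_count n D hD hdis hfin, lintegral_map (by fun_prop) hN]
    congr 1
    rw [← lintegral_indicator_one]
    · rfl
    · have : Measurable fun v : Fin n → ℝ≥0∞ => v + Pi.single j 1 := by fun_prop
      exact (this.comp hN) hT
  rw [hR]
  nth_rw 1 [hS]
  rw [lintegral_biUnion_finset (fun a _ b _ hab => hdis hab) fun j _ => hD j]
  refine Finset.sum_congr rfl fun j _ => ?_
  rw [setLIntegral_congr_fun (g := fun _ => ρ {m | (fun i => m (D i)) + Pi.single j 1 ∈ T})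
    (hD j), setLIntegral_const, mul_comm]
  intro x hx
  simp only
  congr 1
  ext m
  simp only [Set.mem_preimage, Function.comp, Set.mem_ofPred_eq]
  -- A new point in the cell `D j` raises the `j`-th count only, which is the shift found in `hR`.
  have : (fun i => (m + Measure.dirac x) (D i)) = (fun i => m (D i)) + Pi.single j 1 := by
    funext i
    rw [Measure.add_apply, Pi.add_apply, Measure.dirac_apply' _ (hD i)]
    congr 1
    by_cases hij : i = j
    · subst hij; simp [hx]
    · rw [Pi.single_eq_of_ne hij, Set.indicator_of_notMem]
      exact fun hxi => Set.disjoint_left.1 (hdis hij) hxi hx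
  rw [this]

end Poisson

/-! ### The Mecke equation for functionals of a point and the process -/

section Mecke

variable {E : Type*} [MeasurableSpace E]

/-- An s-finite kernel which is the identity on the measures that are finite on each of the
spanning sets of `Λ`. -/
lemma exists_sFinite_kernel (Λ : Measure E) [SigmaFinite Λ] :
    ∃ κ : Kernel (Measure E) E, IsSFiniteKernel κ ∧
      ∀ m : Measure E, (∀ n, m (spanningSets Λ n) ≠ ∞) → κ m = m := by
  classical
  let S : ℕ → Set E := disjointed (spanningSets Λ)
  have hS : ∀ n, MeasurableSet (S n) := MeasurableSet.disjointed (measurableSet_spanningSets Λ)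
  -- The identity kernel is split according to the spanning piece and the integer part `k` of the
  -- mass there. Each part is bounded by `k + 1`, so the sum is s-finite, as composition products
  -- and joint measurability require.
  let U : ℕ × ℕ → Set (Measure E) := fun p => {m | (p.2 : ℝ≥0∞) ≤ m (S p.1) ∧ m (S p.1) < p.2 + 1}
  have hU : ∀ p, MeasurableSet (U p) := fun p =>
    (measurableSet_le measurable_const (Measure.measurable_coe (hS p.1))).inter
      (measurableSet_lt (Measure.measurable_coe (hS p.1)) measurable_const)
  let base : Kernel (Measure E) E := ⟨id, measurable_id⟩
  let κ : ℕ × ℕ → Kernel (Measure E) E := fun p =>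
    Kernel.piecewise (hU p) (Kernel.restrict base (hS p.1)) 0
  have hκ : ∀ p m, κ p m = if m ∈ U p then m.restrict (S p.1) else 0 := by
    intro p m
    simp only [κ, Kernel.piecewise_apply, Kernel.restrict_apply]
    rfl
  have hfin : ∀ p, IsFiniteKernel (κ p) := by
    intro p
    refine ⟨⟨p.2 + 1, by simp, fun m => ?_⟩⟩
    rw [hκ]
    split_ifs with h
    · rw [Measure.restrict_apply_univ]; exact h.2.le
    · simp
  refine ⟨Kernel.sum κ, inferInstance, fun m hm => ?_⟩
  ext B hB
  have hU' : ∀ n, ∃ k : ℕ, ∀ k', m ∈ U (n, k') ↔ k' = k := by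
    intro n
    have hn : m (S n) ≠ ∞ := ne_top_of_le_ne_top (hm n) (measure_mono (disjointed_subset _ n))
    lift m (S n) to ℝ≥0 using hn with r hr
    refine ⟨⌊r⌋₊, fun k' => ?_⟩
    change (k' : ℝ≥0∞) ≤ m (S n) ∧ m (S n) < k' + 1 ↔ _
    rw [← hr, eq_comm, Nat.floor_eq_iff (by simp)]
    norm_cast
  rw [Kernel.sum_apply' _ _ hB, ENNReal.tsum_prod']
  have : ∀ n, ∑' k, κ (n, k) m B = m (B ∩ S n) := by
    intro n
    obtain ⟨k, hk⟩ := hU' n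
    rw [tsum_eq_single k]
    · rw [hκ, if_pos ((hk k).2 rfl), Measure.restrict_apply hB]
    · intro k' hk'
      rw [hκ, if_neg (fun h => hk' ((hk k').1 h))]; simp
  simp_rw [this]
  rw [← measure_iUnion (fun i j hij => ((disjoint_disjointed _) hij).mono
    Set.inter_subset_right Set.inter_subset_right) fun n => hB.inter (hS n),
    ← Set.inter_iUnion, iUnion_disjointed, iUnion_spanningSets, Set.inter_univ]

variable {ρ : Measure (Measure E)} {Λ : Measure E}

/-- The number of points in a set of finite measure is Poisson distributed. -/
lemma IsPoissonLaw.map_apply (h : IsPoissonLaw ρ Λ) {A : Set E} (hA : MeasurableSet A)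
    (hA' : Λ A ≠ ∞) : ρ.map (fun m => m A) = poissonENN (Λ A) := by
  have e := congrArg (Measure.map fun v : Fin 1 → ℝ≥0∞ => v 0)
    (h.map_count 1 (fun _ => A) (fun _ => hA) (Subsingleton.pairwise) fun _ => hA')
  rw [Measure.map_map (measurable_pi_apply 0) (measurable_counts fun _ => hA)] at e
  have e2 := (measurePreserving_eval (fun _ : Fin 1 => poissonENN (Λ A)) 0).map_eq
  exact e.trans e2

lemma IsPoissonLaw.lintegral_comp_count (h : IsPoissonLaw ρ Λ) {A : Set E}
    (hA : MeasurableSet A) (hA' : Λ A ≠ ∞) {f : ℝ≥0∞ → ℝ≥0∞} (hf : Measurable f) :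
    ∫⁻ m, f (m A) ∂ρ = ∫⁻ x, f x ∂poissonENN (Λ A) := by
  rw [← h.map_apply hA hA', lintegral_map hf (Measure.measurable_coe hA)]

/-- The probability that a set is void. -/
lemma IsPoissonLaw.void (h : IsPoissonLaw ρ Λ) {A : Set E} (hA : MeasurableSet A)
    (hA' : Λ A ≠ ∞) : ρ {m | m A = 0} = ENNReal.ofReal (Real.exp (-(Λ A).toReal)) := by
  have e : ρ {m | m A = 0} = ρ.map (fun m => m A) {0} :=
    (Measure.map_apply (Measure.measurable_coe hA) (measurableSet_singleton 0)).symm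
  rw [e, h.map_apply hA hA', poissonENN,
    Measure.map_apply Measurable.of_discrete (measurableSet_singleton 0)]
  have : (fun n : ℕ => (n : ℝ≥0∞)) ⁻¹' {0} = {0} := by ext n; simp
  rw [this, poissonMeasure_singleton]
  simp
  rfl

variable [SigmaFinite Λ]

lemma IsPoissonLaw.lintegral_count (h : IsPoissonLaw ρ Λ) {A : Set E} (hA : MeasurableSet A)
    (hA' : Λ A ≠ ∞) : ∫⁻ m, m A ∂ρ = Λ A := by
  have := h.prob
  have e := congrArg (fun m => m Set.univ) (h.withDensity_count hA hA')
  have : IsFiniteMeasure (Λ.restrict A) := ⟨by simpa using hA'.lt_top⟩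
  rw [withDensity_apply _ MeasurableSet.univ, Measure.restrict_univ,
    Measure.map_apply measurable_add_dirac MeasurableSet.univ, Set.preimage_univ,
    ← Set.univ_prod_univ, Measure.prod_prod, measure_univ, one_mul,
    Measure.restrict_apply_univ] at e
  exact e

lemma IsPoissonLaw.ae_count_ne_top (h : IsPoissonLaw ρ Λ) {A : Set E} (hA : MeasurableSet A)
    (hA' : Λ A ≠ ∞) : ∀ᵐ m ∂ρ, m A ≠ ∞ := by
  filter_upwards [ae_lt_top (Measure.measurable_coe hA) (by rwa [h.lintegral_count hA hA'])]
    with m hm using hm.ne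

lemma IsPoissonLaw.ae_spanningSets (h : IsPoissonLaw ρ Λ) :
    ∀ᵐ m ∂ρ, ∀ n, m (spanningSets Λ n) ≠ ∞ :=
  ae_all_iff.2 fun n => h.ae_count_ne_top (measurableSet_spanningSets Λ n)
    (measure_spanningSets_lt_top Λ n).ne

/-- The Mecke equation. -/
lemma IsPoissonLaw.mecke (h : IsPoissonLaw ρ Λ) {κ : Kernel (Measure E) E} [IsSFiniteKernel κ]
    (hκ : ∀ᵐ m ∂ρ, κ m = m) {W : Set E} (hW : MeasurableSet W) (hW' : Λ W ≠ ∞)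
    {F : E → Measure E → ℝ≥0∞} (hF : Measurable (Function.uncurry F)) :
    ∫⁻ m, ∫⁻ x in W, F x m ∂κ m ∂ρ = ∫⁻ x in W, ∫⁻ m, F x (m + Measure.dirac x) ∂ρ ∂Λ := by
  have := h.prob
  have : IsFiniteMeasure (Λ.restrict W) := ⟨by simpa using hW'.lt_top⟩
  have hg : Measurable fun p : Measure E × E => (p.1 + Measure.dirac p.2, p.2) :=
    measurable_add_dirac.prodMk measurable_snd
  -- The Campbell measure of the process. On a rectangle `U ×ˢ A` this is the Mecke equation for the
  -- fixed set `A ∩ W`.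
  have key : (ρ.prod (Λ.restrict W)).map (fun p => (p.1 + Measure.dirac p.2, p.2)) =
      ρ ⊗ₘ (Kernel.restrict κ hW) := by
    refine Measure.ext_prod fun {U A} hU hA => ?_
    rw [Measure.compProd_apply_prod hU hA, Measure.map_apply hg (hU.prod hA)]
    have e := congrArg (fun m => m U) (h.withDensity_count (A := A ∩ W) (hA.inter hW)
      (ne_top_of_le_ne_top hW' (measure_mono Set.inter_subset_right)))
    rw [withDensity_apply _ hU, Measure.map_apply measurable_add_dirac hU,
      Measure.prod_apply_symm (measurable_add_dirac hU)] at e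
    trans ∫⁻ m in U, m (A ∩ W) ∂ρ
    · rw [e, Measure.prod_apply_symm (hg (hU.prod hA)), ← Measure.restrict_restrict hA,
        ← lintegral_indicator hA]
      refine lintegral_congr fun x => ?_
      by_cases hx : x ∈ A
      · rw [Set.indicator_of_mem hx]
        congr 1
        ext m
        simp [hx]
      · rw [Set.indicator_of_notMem hx]
        convert measure_empty (μ := ρ)
        ext m
        simp [hx]
    · refine lintegral_congr_ae (ae_restrict_of_ae ?_)
      filter_upwards [hκ] with m hm
      rw [Kernel.restrict_apply, hm, Measure.restrict_apply hA]
  have hF' : Measurable fun p : Measure E × E => F p.2 p.1 := hF.comp measurable_swap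
  have e1 := Measure.lintegral_compProd (μ := ρ) (κ := Kernel.restrict κ hW) hF'
  have e2 := lintegral_prod_symm (μ := ρ) (ν := Λ.restrict W) _ (hF'.comp hg).aemeasurable
  rw [← key, lintegral_map hF' hg] at e1
  exact e1.symm.trans e2

end Mecke

/-! ### From random point sets to counting measures; means over typical points -/

section Processes

/-- The counting measure of a set of points. -/
noncomputable def pointMeasure {E : Type*} [MeasurableSpace E] (X : Set E) : Measure E :=
  Measure.sum fun x : X => Measure.dirac (x : E)

lemma pointMeasure_apply {E : Type*} [MeasurableSpace E] (X : Set E) {B : Set E}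
    (hB : MeasurableSet B) : pointMeasure X B = (X ∩ B).encard := by
  rw [pointMeasure, Measure.sum_apply _ hB, ← ENNReal.tsum_set_one,
    tsum_subtype (X ∩ B) (fun _ => (1 : ℝ≥0∞)), tsum_subtype X (fun x => Measure.dirac x B)]
  refine tsum_congr fun x => ?_
  by_cases hx : x ∈ X <;> by_cases hxB : x ∈ B <;> simp [Set.indicator, hx, hxB, hB]

lemma setLIntegral_pointMeasure {E : Type*} [MeasurableSpace E] [MeasurableSingletonClass E]
    (X : Set E) {W : Set E} (hW : MeasurableSet W) (f : E → ℝ≥0∞) :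
    ∫⁻ x in W, f x ∂pointMeasure X = ∑' x : ↥(X ∩ W), f x := by
  rw [← lintegral_indicator hW, pointMeasure, lintegral_sum_measure, tsum_subtype (X ∩ W) f]
  simp_rw [lintegral_dirac]
  rw [tsum_subtype X (W.indicator f), Set.indicator_indicator]

lemma pointMeasure_eq_pointCount {d : ℕ} {Ω : Type*} (X : Ω → Set (Space d)) {B : Set (Space d)}
    (hB : MeasurableSet B) (ω : Ω) : pointMeasure (X ω) B = pointCount X B ω :=
  pointMeasure_apply _ hB

lemma measurable_pointMeasure_processSigma {d : ℕ} {Ω : Type*} (X : Ω → Set (Space d)) :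
    Measurable[processSigma X] fun ω => pointMeasure (X ω) := by
  refine @Measure.measurable_of_measurable_coe _ _ _ (processSigma X) _ fun B hB => ?_
  simp_rw [pointMeasure_eq_pointCount X hB]
  have : Measurable[processSigma X] (pointCount X B) := by
    rw [measurable_iff_comap_le]
    exact le_iSup (fun B : {B : Set (Space d) // MeasurableSet B} =>
      MeasurableSpace.comap (pointCount X B) ⊤) ⟨B, hB⟩
  exact Measurable.of_discrete.comp this

variable {d : ℕ} {Ω : Type*} [MeasurableSpace Ω] {μ : Measure Ω} {X : Ω → Set (Space d)} {c : ℝ≥0}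

lemma IsPoissonProcess.measurable_pointMeasure (h : IsPoissonProcess μ X c) :
    Measurable fun ω => pointMeasure (X ω) := by
  refine Measure.measurable_of_measurable_coe _ fun B hB => ?_
  simp_rw [pointMeasure_eq_pointCount X hB]
  exact Measurable.of_discrete.comp (h.measurable_count B hB)

lemma IndepProcesses.indepFun {Y : Ω → Set (Space d)} (h : IndepProcesses μ X Y) :
    IndepFun (fun ω => pointMeasure (X ω)) (fun ω => pointMeasure (Y ω)) μ := by
  rw [IndepFun_iff_Indep]
  refine indep_of_indep_of_le_left (indep_of_indep_of_le_right h ?_) ?_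
  · exact (measurable_pointMeasure_processSigma Y).comap_le
  · exact (measurable_pointMeasure_processSigma X).comap_le

/-- The law of the counting measure of a Poisson process. -/
lemma IsPoissonProcess.isPoissonLaw [IsProbabilityMeasure μ] (h : IsPoissonProcess μ X c)
    (hc : c ≠ 0) :
    IsPoissonLaw (μ.map fun ω => pointMeasure (X ω)) (c • volume) := by
  have hM := h.measurable_pointMeasure
  refine ⟨Measure.isProbabilityMeasure_map hM.aemeasurable, fun n D hD hdis hfin => ?_⟩
  rw [Measure.map_map (measurable_counts hD) hM]
  have hcount : ∀ i, Measurable fun ω => ((pointCount X (D i) ω : ℕ∞) : ℝ≥0∞) := fun i =>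
    Measurable.of_discrete.comp (h.measurable_count _ (hD i))
  have e1 : ((fun (m : Measure (Space d)) i => m (D i)) ∘ fun ω => pointMeasure (X ω)) =
      fun ω i => ((pointCount X (D i) ω : ℕ∞) : ℝ≥0∞) := by
    funext ω i
    exact pointMeasure_eq_pointCount X (hD i) ω
  have hind := (h.indep_count n D hD hdis).comp (fun _ k => (k : ℝ≥0∞))
    (fun _ => Measurable.of_discrete)
  rw [e1]
  refine ((iIndepFun_iff_map_fun_eq_pi_map fun i => (hcount i).aemeasurable).1 hind).trans ?_
  congr 1
  funext i
  have hvol : volume (D i) ≠ ∞ := by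
    -- Since `c ≠ 0`, infinite volume would force infinite intensity.
    intro hv
    apply hfin i
    rw [Measure.smul_apply, hv, ENNReal.smul_def, smul_eq_mul, ENNReal.mul_top (by simpa using hc)]
  have e2 : (c • volume) (D i) = ((c * (volume (D i)).toNNReal : ℝ≥0) : ℝ≥0∞) := by
    rw [Measure.smul_apply, ENNReal.smul_def, smul_eq_mul, ENNReal.coe_mul,
      ENNReal.coe_toNNReal hvol]
  have e3 : μ.map (pointCount X (D i)) =
      (poissonMeasure (c * (volume (D i)).toNNReal)).map (fun n : ℕ => (n : ℕ∞)) := by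
    have hp : IsProbabilityMeasure (μ.map (pointCount X (D i))) :=
      Measure.isProbabilityMeasure_map (h.measurable_count _ (hD i)).aemeasurable
    have hp' : IsProbabilityMeasure ((poissonMeasure (c * (volume (D i)).toNNReal)).map
      (fun n : ℕ => (n : ℕ∞))) :=
      Measure.isProbabilityMeasure_map Measurable.of_discrete.aemeasurable
    -- `law_count` fixes the law only at finite counts, which gives an inequality. Both sides have
    -- total mass one, so they agree and the count `∞` has probability zero.
    have hle : ((poissonMeasure (c * (volume (D i)).toNNReal)).map
        (fun n : ℕ => (n : ℕ∞))) ≤ μ.map (pointCount X (D i)) := by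
      refine Measure.le_iff.2 fun s _ => ?_
      rw [Measure.map_apply Measurable.of_discrete (by trivial),
        Measure.map_apply (h.measurable_count _ (hD i)) (by trivial)]
      calc _ = ∑' n : (fun n : ℕ => (n : ℕ∞)) ⁻¹' s,
            poissonMeasure (c * (volume (D i)).toNNReal) {(n : ℕ)} := by
            rw [← measure_biUnion (f := fun n : ℕ => {n}) (Set.to_countable _)
              (fun a _ b _ hab => Set.disjoint_singleton.2 hab)
              fun _ _ => MeasurableSet.singleton _, Set.biUnion_of_singleton]
        _ = ∑' n : (fun n : ℕ => (n : ℕ∞)) ⁻¹' s, μ {ω | pointCount X (D i) ω = (n : ℕ)} := by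
            simp_rw [h.law_count _ (hD i) hvol]
        _ = μ (⋃ n ∈ (fun n : ℕ => (n : ℕ∞)) ⁻¹' s, {ω | pointCount X (D i) ω = (n : ℕ)}) := by
            rw [measure_biUnion (Set.to_countable _)]
            · intro a _ b _ hab
              refine Set.disjoint_left.2 fun ω ha hb => hab ?_
              have := ha.symm.trans hb
              exact_mod_cast this
            · exact fun n _ => h.measurable_count _ (hD i) (t := {(n : ℕ∞)}) (by trivial)
        _ ≤ _ := by
            refine measure_mono ?_
            intro ω hω
            simp only [Set.mem_iUnion] at hω
            obtain ⟨n, hn, hω⟩ := hω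
            have hω' : pointCount X (D i) ω = n := hω
            change pointCount X (D i) ω ∈ s
            rw [hω']; exact hn
    exact (Measure.eq_of_le_of_isProbabilityMeasure hle).symm
  have e4 : μ.map (fun ω => ((pointCount X (D i) ω : ℕ∞) : ℝ≥0∞)) =
      (μ.map (pointCount X (D i))).map (fun k : ℕ∞ => (k : ℝ≥0∞)) :=
    (Measure.map_map Measurable.of_discrete (h.measurable_count _ (hD i))).symm
  refine e4.trans ?_
  rw [e3, Measure.map_map Measurable.of_discrete Measurable.of_discrete, poissonENN, e2,
    ENNReal.toNNReal_coe]
  rfl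

lemma measurable_setLIntegral_kernel {E β : Type*} [MeasurableSpace E] [MeasurableSpace β]
    {κ : Kernel (Measure E) E} [IsSFiniteKernel κ] {W : Set E} (hW : MeasurableSet W)
    {G : E → Measure E → β → ℝ≥0∞} (hG : Measurable fun p : E × Measure E × β => G p.1 p.2.1 p.2.2) :
    Measurable fun p : Measure E × β => ∫⁻ x in W, G x p.1 p.2 ∂κ p.1 := by
  have := Measurable.lintegral_kernel_prod_right
    (κ := (Kernel.restrict κ hW).comap (Prod.fst : Measure E × β → _) measurable_fst)
    (f := fun p x => G x p.1 p.2)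
    (hG.comp (measurable_snd.prodMk (measurable_fst.fst.prodMk measurable_fst.snd)))
  simpa using this

section Sums

variable {β : Type*} {Y : Ω → β}
  {κ : Kernel (Measure (Space d)) (Space d)} {W : Set (Space d)}
  {G : Space d → Measure (Space d) → β → ℝ≥0∞} {f : Ω → Space d → ℝ≥0∞}

/-- Integration against `pointMeasure` is summation over the points, and `κ` is almost surely the
identity. The kernel form supplies the measurability that the raw sum lacks. -/
lemma IsPoissonProcess.sum_ae_eq (h : IsPoissonProcess μ X c)
    (hκ : ∀ᵐ m ∂μ.map fun ω => pointMeasure (X ω), κ m = m) (hW : MeasurableSet W)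
    (hf : ∀ᵐ ω ∂μ, ∀ x ∈ X ω, f ω x = G x (pointMeasure (X ω)) (Y ω)) :
    (fun ω => ∑' x : ↥(X ω ∩ W), f ω x) =ᵐ[μ]
      fun ω => ∫⁻ x in W, G x (pointMeasure (X ω)) (Y ω) ∂κ (pointMeasure (X ω)) := by
  filter_upwards [ae_of_ae_map h.measurable_pointMeasure.aemeasurable hκ, hf] with ω hω hfω
  rw [hω, setLIntegral_pointMeasure _ hW]
  exact tsum_congr fun x => hfω x x.2.1

variable [MeasurableSpace β] [IsProbabilityMeasure μ] [IsSFiniteKernel κ]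

/-- The Mecke equation for sums over the points of a Poisson process `X`, where the summands may
depend on a random element `Y` independent of `X`. -/
lemma IsPoissonProcess.lintegral_sum (h : IsPoissonProcess μ X c) (hc : c ≠ 0) (hY : Measurable Y)
    (hind : IndepFun (fun ω => pointMeasure (X ω)) Y μ)
    (hκ : ∀ᵐ m ∂μ.map fun ω => pointMeasure (X ω), κ m = m)
    (hW : MeasurableSet W) (hW' : volume W ≠ ∞)
    (hG : Measurable fun p : Space d × Measure (Space d) × β => G p.1 p.2.1 p.2.2)
    (hf : ∀ᵐ ω ∂μ, ∀ x ∈ X ω, f ω x = G x (pointMeasure (X ω)) (Y ω)) :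
    ∫⁻ ω, ∑' x : ↥(X ω ∩ W), f ω x ∂μ =
      ∫⁻ x in W, ∫⁻ y, ∫⁻ m, G x (m + Measure.dirac x) y ∂μ.map (fun ω => pointMeasure (X ω))
        ∂μ.map Y ∂(c • volume) := by
  have hM := h.measurable_pointMeasure
  have hlaw := h.isPoissonLaw hc
  have hp1 := hlaw.prob
  have hp2 : IsProbabilityMeasure (μ.map Y) := Measure.isProbabilityMeasure_map hY.aemeasurable
  have hprod := (indepFun_iff_map_prod_eq_prod_map_map hM.aemeasurable hY.aemeasurable).1 hind
  have hH := measurable_setLIntegral_kernel (κ := κ) hW hG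
  calc ∫⁻ ω, ∑' x : ↥(X ω ∩ W), f ω x ∂μ
      = ∫⁻ ω, ∫⁻ x in W, G x (pointMeasure (X ω)) (Y ω) ∂κ (pointMeasure (X ω)) ∂μ :=
        lintegral_congr_ae (h.sum_ae_eq hκ hW hf)
    _ = ∫⁻ p, ∫⁻ x in W, G x p.1 p.2 ∂κ p.1
          ∂(μ.map fun ω => pointMeasure (X ω)).prod (μ.map Y) := by
        rw [← hprod, lintegral_map hH (hM.prodMk hY)]
    _ = ∫⁻ y, ∫⁻ m, ∫⁻ x in W, G x m y ∂κ m ∂μ.map (fun ω => pointMeasure (X ω)) ∂μ.map Y :=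
        lintegral_prod_symm _ hH.aemeasurable
    _ = ∫⁻ y, ∫⁻ x in W, ∫⁻ m, G x (m + Measure.dirac x) y ∂μ.map (fun ω => pointMeasure (X ω))
          ∂(c • volume) ∂μ.map Y := by
        refine lintegral_congr fun y => ?_
        refine hlaw.mecke hκ hW (by simpa using ENNReal.mul_ne_top ENNReal.coe_ne_top hW')
          (F := fun x m => G x m y) ?_
        exact hG.comp (measurable_fst.prodMk (measurable_snd.prodMk measurable_const))
    _ = _ := by
        rw [lintegral_lintegral_swap]
        refine Measurable.aemeasurable ?_
        refine Measurable.lintegral_prod_right'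
          (f := fun q : (β × Space d) × Measure (Space d) => 
            G q.1.2 (q.2 + Measure.dirac q.1.2) q.1.1) ?_
        exact hG.comp ((measurable_fst.snd).prodMk ((measurable_add_dirac.comp
          (measurable_snd.prodMk measurable_fst.snd)).prodMk measurable_fst.fst))

/-- A nonnegative quantity whose Palm mean vanishes almost surely vanishes at all points. -/
lemma IsPoissonProcess.ae_forall_eq_zero (h : IsPoissonProcess μ X c) (hc : c ≠ 0)
    (hY : Measurable Y) (hind : IndepFun (fun ω => pointMeasure (X ω)) Y μ)
    (hκ : ∀ᵐ m ∂μ.map fun ω => pointMeasure (X ω), κ m = m)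
    (hG : Measurable fun p : Space d × Measure (Space d) × β => G p.1 p.2.1 p.2.2)
    (hf : ∀ᵐ ω ∂μ, ∀ x ∈ X ω, f ω x = G x (pointMeasure (X ω)) (Y ω))
    (h0 : ∀ x, ∫⁻ y, ∫⁻ m, G x (m + Measure.dirac x) y ∂μ.map (fun ω => pointMeasure (X ω))
        ∂μ.map Y = 0) :
    ∀ᵐ ω ∂μ, ∀ x ∈ X ω, f ω x = 0 := by
  -- Countably many balls exhaust the space, and in each the sum has expectation zero.
  have hn : ∀ n : ℕ, ∀ᵐ ω ∂μ, ∑' x : ↥(X ω ∩ Metric.ball 0 n), f ω x = 0 := by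
    intro n
    have hB : MeasurableSet (Metric.ball (0 : Space d) n) := Metric.isOpen_ball.measurableSet
    have e := h.lintegral_sum hc hY hind hκ hB measure_ball_lt_top.ne hG hf
    simp_rw [h0, lintegral_zero] at e
    refine (lintegral_eq_zero_iff' ?_).1 e
    exact ((measurable_setLIntegral_kernel hB hG).comp
      (h.measurable_pointMeasure.prodMk hY)).aemeasurable.congr (h.sum_ae_eq hκ hB hf).symm
  filter_upwards [ae_all_iff.2 hn] with ω hω x hx
  obtain ⟨n, hxn⟩ := exists_nat_gt ‖x‖
  exact ENNReal.tsum_eq_zero.1 (hω n) ⟨x, hx, by simpa using hxn⟩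

end Sums

lemma IsPoissonProcess.lintegral_pointCount [IsProbabilityMeasure μ] (h : IsPoissonProcess μ X c)
    (hc : c ≠ 0) {W : Set (Space d)} (hW : MeasurableSet W) (hW' : volume W ≠ ∞) :
    ∫⁻ ω, (pointCount X W ω : ℝ≥0∞) ∂μ = c * volume W := by
  have e := (h.isPoissonLaw hc).lintegral_count hW
    (by simpa using ENNReal.mul_ne_top ENNReal.coe_ne_top hW')
  rw [lintegral_map (Measure.measurable_coe hW) h.measurable_pointMeasure] at e
  simp_rw [pointMeasure_eq_pointCount X hW] at e
  simpa using e

/-- The mean over a typical point, for functionals whose Palm mean is the same at all points. -/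
lemma IsPoissonProcess.typicalMean_eq [IsProbabilityMeasure μ] (h : IsPoissonProcess μ X c)
    (hc : c ≠ 0) {β : Type*} [MeasurableSpace β] {Y : Ω → β} (hY : Measurable Y)
    (hind : IndepFun (fun ω => pointMeasure (X ω)) Y μ)
    {κ : Kernel (Measure (Space d)) (Space d)} [IsSFiniteKernel κ]
    (hκ : ∀ᵐ m ∂μ.map fun ω => pointMeasure (X ω), κ m = m)
    {W : Set (Space d)} (hW : MeasurableSet W) (hW0 : volume W ≠ 0) (hW' : volume W ≠ ∞)
    {G : Space d → Measure (Space d) → β → ℝ≥0∞}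
    (hG : Measurable fun p : Space d × Measure (Space d) × β => G p.1 p.2.1 p.2.2)
    {f : Ω → Space d → ℝ≥0∞}
    (hf : ∀ᵐ ω ∂μ, ∀ x ∈ X ω, f ω x = G x (pointMeasure (X ω)) (Y ω)) {C : ℝ≥0∞}
    (hC : ∀ x, ∫⁻ y, ∫⁻ m, G x (m + Measure.dirac x) y ∂μ.map (fun ω => pointMeasure (X ω))
        ∂μ.map Y = C) :
    typicalMean μ X W f = C := by
  rw [typicalMean, h.lintegral_sum hc hY hind hκ hW hW' hG hf, h.lintegral_pointCount hc hW hW']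
  simp_rw [hC]
  have h0 : (c : ℝ≥0∞) * volume W ≠ 0 := mul_ne_zero (by simpa using hc) hW0
  rw [setLIntegral_const, Measure.smul_apply, ENNReal.smul_def, smul_eq_mul,
    ENNReal.mul_div_cancel_right h0 (ENNReal.mul_ne_top ENNReal.coe_ne_top hW')]

end Processes

/-! ### Void regions: measurability, scaling and the law of their volume -/

section Regions

variable {d : ℕ}

/-- The points `y` for which the open ball of radius `‖x - y‖` with centre `x` (if `out`) or `y`
(otherwise) is `m`-null. -/
def voidRegion (out : Bool) (x : Space d) (m : Measure (Space d)) : Set (Space d) :=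
  {y | m (Metric.ball (bif out then x else y) ‖x - y‖) = 0}

/-- An open ball is the union of the rational-radius balls about a countable dense set that the
triangle inequality places inside it, so being null is a countable condition. -/
lemma measurableSet_null_ball :
    MeasurableSet {p : (Space d × ℝ) × Measure (Space d) | p.2 (Metric.ball p.1.1 p.1.2) = 0} := by
  obtain ⟨Q, hQ, hQd⟩ := TopologicalSpace.exists_countable_dense (Space d)
  have heq : {p : (Space d × ℝ) × Measure (Space d) | p.2 (Metric.ball p.1.1 p.1.2) = 0} =
      ⋂ q ∈ Q, ⋂ r : ℚ, {p : (Space d × ℝ) × Measure (Space d) |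
        dist q p.1.1 + (r : ℝ) < p.1.2 → p.2 (Metric.ball q r) = 0} := by
    ext ⟨⟨x, ρ⟩, m⟩
    simp only [Set.mem_iInter, Set.mem_ofPred_eq]
    constructor
    · intro h q _ r hr
      refine measure_mono_null (fun z hz => ?_) h
      rw [Metric.mem_ball] at hz ⊢
      linarith [dist_triangle z q x]
    · intro h
      have hsub : Metric.ball x ρ ⊆
          ⋃ q ∈ Q, ⋃ r : ℚ, ⋃ _ : dist q x + (r : ℝ) < ρ, Metric.ball q r := by
        intro z hz
        rw [Metric.mem_ball] at hz
        -- With `δ` the distance left from `z` to the sphere, `q` lies within `δ / 3` of `z` and `r`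
        -- between `δ / 3` and `2 * δ / 3`. The small ball then contains `z` and stays inside.
        obtain ⟨q, hq, hzq⟩ := hQd.exists_dist_lt z (show 0 < (ρ - dist z x) / 3 by linarith)
        obtain ⟨r, hr1, hr2⟩ := exists_rat_btwn
          (show (ρ - dist z x) / 3 < 2 * ((ρ - dist z x) / 3) by linarith)
        simp only [Set.mem_iUnion]
        refine ⟨q, hq, r, ?_, ?_⟩
        · have := dist_triangle q z x
          rw [dist_comm] at hzq
          linarith
        · rw [Metric.mem_ball]; linarith
      refine measure_mono_null hsub ?_
      refine (measure_biUnion_null_iff hQ).2 fun q hq => measure_iUnion_null fun r =>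
        measure_iUnion_null fun hr => h q hq r hr
  rw [heq]
  refine MeasurableSet.biInter hQ fun q _ => MeasurableSet.iInter fun r => ?_
  refine MeasurableSet.imp ?_ ?_
  · exact measurableSet_lt ((measurable_const.dist measurable_fst.fst).add_const _)
      measurable_fst.snd
  · exact (Measure.measurable_coe Metric.isOpen_ball.measurableSet).comp measurable_snd
      (measurableSet_singleton 0)

lemma measurableSet_voidRegion_graph (out : Bool) :
    MeasurableSet {p : (Space d × Measure (Space d)) × Space d |
      p.2 ∈ voidRegion out p.1.1 p.1.2} := by
  have : Measurable fun p : (Space d × Measure (Space d)) × Space d =>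
      (((bif out then p.1.1 else p.2), ‖p.1.1 - p.2‖), p.1.2) := by
    cases out <;> simp only [cond_true, cond_false] <;> fun_prop
  exact this measurableSet_null_ball

lemma measurableSet_voidRegion (out : Bool) (x : Space d) (m : Measure (Space d)) :
    MeasurableSet (voidRegion out x m) :=
  (measurable_prodMk_left (x := (x, m))) (measurableSet_voidRegion_graph out)

lemma measurable_volume_voidRegion (out : Bool) :
    Measurable fun p : Space d × Measure (Space d) => volume (voidRegion out p.1 p.2) :=
  measurable_measure_prodMk_left (measurableSet_voidRegion_graph out)

lemma measurable_volume_voidRegion_right (out : Bool) (x : Space d) :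
    Measurable fun m : Measure (Space d) => volume (voidRegion out x m) :=
  (measurable_volume_voidRegion out).comp measurable_prodMk_left

lemma volume_preimage_add_smul (a : Space d) {s : ℝ≥0} (hs : s ≠ 0) (A : Set (Space d)) :
    volume ((fun y => a + s • y) ⁻¹' A) = ((s ^ d)⁻¹ : ℝ≥0) * volume A := by
  have h1 : (fun y : Space d => a + s • y) ⁻¹' A = (fun y => (s : ℝ) • y) ⁻¹' ((a + ·) ⁻¹' A) := rfl
  rw [h1, Measure.addHaar_preimage_smul volume (by simpa using hs), measure_preimage_add]
  congr 1
  rw [finrank_euclideanSpace_fin, abs_of_nonneg (by positivity), ← NNReal.coe_pow, ← NNReal.coe_inv,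
    ENNReal.ofReal_coe_nnreal]

/-- A similarity multiplies all distances by `s`, so it carries the test balls to the test balls. -/
lemma preimage_voidRegion_map (out : Bool) (a : Space d) {s : ℝ≥0} (hs : s ≠ 0) (x : Space d)
    (m : Measure (Space d)) :
    (fun y => a + s • y) ⁻¹' voidRegion out (a + s • x) (m.map fun y => a + s • y) =
      voidRegion out x m := by
  have hs' : 0 < (s : ℝ) := by positivity
  have hd : ∀ u v : Space d, dist (a + s • u) (a + s • v) = s * dist u v := by
    intro u v
    rw [dist_add_left, NNReal.smul_def, NNReal.smul_def, dist_smul₀, Real.norm_of_nonneg hs'.le]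
  ext y
  simp only [voidRegion, Set.mem_preimage, Set.mem_ofPred_eq]
  rw [Measure.map_apply (by fun_prop) Metric.isOpen_ball.measurableSet]
  have : (fun y => a + s • y) ⁻¹' Metric.ball (bif out then a + s • x else a + s • y)
      ‖(a + s • x) - (a + s • y)‖ = Metric.ball (bif out then x else y) ‖x - y‖ := by
    ext z
    rw [Set.mem_preimage, Metric.mem_ball, Metric.mem_ball, ← dist_eq_norm, ← dist_eq_norm, hd]
    cases out <;> simp only [cond_true, cond_false, hd] <;>
      exact mul_lt_mul_iff_right₀ hs'
  rw [this]

lemma volume_voidRegion_map (out : Bool) (a : Space d) {s : ℝ≥0} (hs : s ≠ 0) (x : Space d)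
    (m : Measure (Space d)) :
    volume (voidRegion out (a + s • x) (m.map fun y => a + s • y)) =
      (s ^ d : ℝ≥0) * volume (voidRegion out x m) := by
  rw [← preimage_voidRegion_map out a hs x m, volume_preimage_add_smul a hs, ← mul_assoc,
    ← ENNReal.coe_mul, mul_inv_cancel₀ (pow_ne_zero d hs), ENNReal.coe_one, one_mul]

/-- The similarity divides the intensity by `s ^ d`, and a Poisson law is determined by its
intensity. -/
lemma IsPoissonLaw.map_add_smul {ρ ρ' : Measure (Measure (Space d))} {c c' : ℝ≥0}
    (h : IsPoissonLaw ρ (c • volume)) (h' : IsPoissonLaw ρ' (c' • volume)) (a : Space d) {s : ℝ≥0}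
    (hs : s ≠ 0) (hc : c' * s ^ d = c) :
    ρ.map (Measure.map fun y => a + s • y) = ρ' := by
  have hT : Measurable fun y : Space d => a + s • y := by fun_prop
  have e : (c • (volume : Measure (Space d))).map (fun y => a + s • y) = c' • volume := by
    ext A hA
    rw [Measure.map_apply hT hA, Measure.smul_apply, Measure.smul_apply,
      volume_preimage_add_smul a hs, ENNReal.smul_def, ENNReal.smul_def, smul_eq_mul, smul_eq_mul,
      ← mul_assoc, ← ENNReal.coe_mul, ← hc, mul_assoc, mul_inv_cancel₀ (pow_ne_zero d hs), mul_one]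
  have := h.map hT
  rw [e] at this
  exact this.unique h'

lemma lintegral_voidRegion_map {ρ ρ' : Measure (Measure (Space d))} {c c' : ℝ≥0}
    (h : IsPoissonLaw ρ (c • volume)) (h' : IsPoissonLaw ρ' (c' • volume)) (out : Bool)
    (a x : Space d) {s : ℝ≥0} (hs : s ≠ 0) (hc : c' * s ^ d = c) {g : ℝ≥0∞ → ℝ≥0∞}
    (hg : Measurable g) :
    ∫⁻ m, g (volume (voidRegion out (a + s • x) m)) ∂ρ' =
      ∫⁻ m, g ((s ^ d : ℝ≥0) * volume (voidRegion out x m)) ∂ρ := by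
  have hm : Measurable fun m => g (volume (voidRegion out (a + s • x) m)) :=
    hg.comp (measurable_volume_voidRegion_right out _)
  rw [← h.map_add_smul h' a hs hc, lintegral_map hm (Measure.measurable_map _ (by fun_prop))]
  simp_rw [volume_voidRegion_map out a hs]

/-- The law of the volume of a void region does not depend on the base point. -/
lemma IsPoissonLaw.lintegral_voidRegion {ρ : Measure (Measure (Space d))} {c : ℝ≥0}
    (h : IsPoissonLaw ρ (c • volume)) (out : Bool) (x : Space d) {g : ℝ≥0∞ → ℝ≥0∞}
    (hg : Measurable g) :
    ∫⁻ m, g (volume (voidRegion out x m)) ∂ρ = ∫⁻ m, g (volume (voidRegion out 0 m)) ∂ρ := by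
  have := lintegral_voidRegion_map h h out x 0 one_ne_zero (by simp) hg
  simpa using this

/-- Scaling of the law of the volume of a void region. -/
lemma lintegral_voidRegion_intensity (hd : 1 ≤ d) {ρ ρ' : Measure (Measure (Space d))} {c : ℝ≥0}
    (hc : c ≠ 0) (h : IsPoissonLaw ρ ((1 : ℝ≥0) • volume)) (h' : IsPoissonLaw ρ' (c • volume))
    (out : Bool) {g : ℝ≥0∞ → ℝ≥0∞} (hg : Measurable g) :
    ∫⁻ m, g (volume (voidRegion out 0 m)) ∂ρ' =
      ∫⁻ m, g ((c⁻¹ : ℝ≥0) * volume (voidRegion out 0 m)) ∂ρ := by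
  -- The dilation factor is `c ^ (-1/d)`: it turns intensity `1` into `c` and multiplies volumes by
  -- `c⁻¹`.
  have hpow : (c⁻¹ ^ ((d : ℝ)⁻¹)) ^ d = c⁻¹ := NNReal.rpow_inv_natCast_pow _ (by omega)
  have hs : c⁻¹ ^ ((d : ℝ)⁻¹) ≠ 0 := by
    intro h0
    rw [h0, zero_pow (by omega)] at hpow
    exact inv_ne_zero hc hpow.symm
  have := lintegral_voidRegion_map h h' out 0 0 hs (by rw [hpow, mul_inv_cancel₀ hc]) hg
  rw [hpow] at this
  simpa using this

lemma exists_volume_ball_eq (hd : 1 ≤ d) {s : ℝ} (hs : 0 ≤ s) :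
    ∃ r : ℝ, 0 ≤ r ∧ volume (Metric.ball (0 : Space d) r) = ENNReal.ofReal s := by
  have : Nonempty (Fin d) := ⟨⟨0, hd⟩⟩
  set v := volume (Metric.ball (0 : Space d) 1) with hv
  have hv0 : 0 < v.toReal := ENNReal.toReal_pos (Metric.measure_ball_pos _ _ one_pos).ne'
    measure_ball_lt_top.ne
  refine ⟨(s / v.toReal) ^ ((d : ℝ)⁻¹), by positivity, ?_⟩
  rw [Measure.addHaar_ball _ _ (by positivity), finrank_euclideanSpace_fin,
    Real.rpow_inv_natCast_pow (by positivity) (by omega), ← hv]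
  nth_rw 2 [← ENNReal.ofReal_toReal (a := v) measure_ball_lt_top.ne]
  rw [← ENNReal.ofReal_mul (by positivity), div_mul_cancel₀ _ hv0.ne']

variable {ρ : Measure (Measure (Space d))} {c : ℝ≥0}

lemma IsPoissonLaw.void_ball (h : IsPoissonLaw ρ (c • volume)) (x : Space d) (r : ℝ) :
    ρ {m | m (Metric.ball x r) = 0} =
      ENNReal.ofReal (Real.exp (-(c * (volume (Metric.ball (0 : Space d) r)).toReal))) := by
  have hb : (c • (volume : Measure (Space d))) (Metric.ball x r) =
      c * volume (Metric.ball (0 : Space d) r) := by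
    rw [Measure.smul_apply, ENNReal.smul_def, smul_eq_mul, Measure.addHaar_ball_center]
  rw [h.void Metric.isOpen_ball.measurableSet, hb, ENNReal.toReal_mul, ENNReal.coe_toReal]
  rw [hb]
  exact ENNReal.mul_ne_top ENNReal.coe_ne_top measure_ball_lt_top.ne

/-- The volume of the empty ball around the origin has exponential tails. -/
lemma IsPoissonLaw.tail_voidRegion (hd : 1 ≤ d) (h : IsPoissonLaw ρ (c • volume)) {s : ℝ}
    (hs : 0 ≤ s) :
    ρ {m | ENNReal.ofReal s < volume (voidRegion true 0 m)} =
      ENNReal.ofReal (Real.exp (-(c * s))) := by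
  have : Nonempty (Fin d) := ⟨⟨0, hd⟩⟩
  have hvoid : ∀ t : ℝ, 0 ≤ t → ∃ r : ℝ, 0 ≤ r ∧
      volume (Metric.ball (0 : Space d) r) = ENNReal.ofReal t ∧
      ρ {m | m (Metric.ball 0 r) = 0} = ENNReal.ofReal (Real.exp (-(c * t))) := by
    intro t ht
    obtain ⟨r, hr, hv⟩ := exists_volume_ball_eq hd ht
    exact ⟨r, hr, hv, by rw [h.void_ball, hv, ENNReal.toReal_ofReal ht]⟩
  refine le_antisymm ?_ ?_
  · obtain ⟨r, hr, hv, hp⟩ := hvoid s hs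
    rw [← hp]
    refine measure_mono fun m hm => ?_
    -- A region larger than the ball of volume `s` has a point outside the closed ball, so the open
    -- ball is void.
    have hm' : ¬ voidRegion true 0 m ⊆ Metric.closedBall 0 r := by
      intro hsub
      have := measure_mono (μ := volume) hsub
      rw [Measure.addHaar_closedBall_eq_addHaar_ball, hv] at this
      exact absurd hm (not_lt.2 this)
    obtain ⟨y, hy, hyr⟩ := Set.not_subset.1 hm'
    have hy' : m (Metric.ball 0 ‖0 - y‖) = 0 := hy
    refine measure_mono_null (Metric.ball_subset_ball ?_) hy'
    rw [mem_closedBall_zero_iff, not_le] at hyr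
    simpa using hyr.le
  · have hlow : ∀ t : ℝ, s < t → ENNReal.ofReal (Real.exp (-(c * t))) ≤
        ρ {m | ENNReal.ofReal s < volume (voidRegion true 0 m)} := by
      intro t hst
      obtain ⟨r, hr, hv, hp⟩ := hvoid t (hs.trans hst.le)
      rw [← hp]
      refine measure_mono fun m hm => ?_
      have hsub : Metric.ball 0 r ⊆ voidRegion true 0 m := by
        intro y hy
        refine measure_mono_null (Metric.ball_subset_ball ?_) hm
        simpa using (mem_ball_zero_iff.1 hy).le
      refine lt_of_lt_of_le ?_ (measure_mono hsub)
      rw [hv]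
      exact (ENNReal.ofReal_lt_ofReal_iff (hs.trans_lt hst)).2 hst
    have hcont : Filter.Tendsto (fun t : ℝ => ENNReal.ofReal (Real.exp (-(c * t))))
        (nhdsWithin s (Set.Ioi s)) (nhds (ENNReal.ofReal (Real.exp (-(c * s))))) := by
      have : Continuous fun t : ℝ => ENNReal.ofReal (Real.exp (-(c * t))) :=
        ENNReal.continuous_ofReal.comp (by fun_prop)
      exact this.continuousAt.continuousWithinAt
    exact le_of_tendsto hcont (by filter_upwards [self_mem_nhdsWithin] with t ht using hlow t ht)

lemma IsPoissonLaw.ae_volume_voidRegion_true_ne_top (hd : 1 ≤ d) (hc : c ≠ 0)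
    (h : IsPoissonLaw ρ (c • volume)) : ∀ᵐ m ∂ρ, volume (voidRegion true 0 m) ≠ ∞ := by
  have hle : ∀ s : ℝ, 0 ≤ s → ρ {m | ¬ volume (voidRegion true 0 m) ≠ ∞} ≤
      ENNReal.ofReal (Real.exp (-(c * s))) := by
    intro s hs
    rw [← h.tail_voidRegion hd hs]
    refine measure_mono fun m hm => ?_
    have hm' : volume (voidRegion true 0 m) = ∞ := not_not.1 hm
    change ENNReal.ofReal s < volume (voidRegion true 0 m)
    rw [hm']; exact ENNReal.ofReal_lt_top
  have hlim : Filter.Tendsto (fun s : ℝ => ENNReal.ofReal (Real.exp (-(c * s)))) Filter.atTop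
      (nhds 0) := by
    rw [← ENNReal.ofReal_zero]
    refine ENNReal.tendsto_ofReal (Real.tendsto_exp_neg_atTop_nhds_zero.comp ?_)
    exact Filter.tendsto_id.const_mul_atTop (by positivity)
  exact le_antisymm (ge_of_tendsto hlim (by
    filter_upwards [Filter.eventually_ge_atTop 0] with s hs using hle s hs)) zero_le

/-- The volume of the empty ball around the origin is exponentially distributed. -/
lemma IsPoissonLaw.map_voidRegion (hd : 1 ≤ d) (hc : c ≠ 0) (h : IsPoissonLaw ρ (c • volume)) :
    ρ.map (fun m => (volume (voidRegion true 0 m)).toReal) = expMeasure c := by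
  have := h.prob
  have hc' : 0 < (c : ℝ) := by positivity
  have hm : Measurable fun m : Measure (Space d) => (volume (voidRegion true 0 m)).toReal :=
    (measurable_volume_voidRegion_right true 0).ennreal_toReal
  have := isProbabilityMeasure_expMeasure hc'
  have := Measure.isProbabilityMeasure_map (μ := ρ) hm.aemeasurable
  refine Measure.eq_of_cdf _ _ (StieltjesFunction.ext fun x => ?_)
  rw [cdf_expMeasure_eq hc', cdf_eq_real, measureReal_def, Measure.map_apply hm measurableSet_Iic]
  split_ifs with hx
  · have e : ρ ((fun m => (volume (voidRegion true 0 m)).toReal) ⁻¹' Set.Iic x)ᶜ =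
        ENNReal.ofReal (Real.exp (-(c * x))) := by
      rw [← h.tail_voidRegion hd hx]
      refine measure_congr ?_
      filter_upwards [h.ae_volume_voidRegion_true_ne_top hd hc] with m hmt
      refine propext ?_
      change ¬ ((volume (voidRegion true 0 m)).toReal ≤ x) ↔
        ENNReal.ofReal x < volume (voidRegion true 0 m)
      rw [not_le, ENNReal.ofReal_lt_iff_lt_toReal hx hmt]
    have e2 := prob_compl_eq_one_sub (μ := ρ) (hm measurableSet_Iic).compl
      (s := ((fun m => (volume (voidRegion true 0 m)).toReal) ⁻¹' Set.Iic x)ᶜ)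
    rw [compl_compl, e] at e2
    rw [e2, ENNReal.toReal_sub_of_le _ ENNReal.one_ne_top, ENNReal.toReal_one,
      ENNReal.toReal_ofReal (Real.exp_pos _).le]
    rw [ENNReal.ofReal_le_one]
    exact Real.exp_le_one_iff.2 (by nlinarith)
  · have : (fun m : Measure (Space d) => (volume (voidRegion true 0 m)).toReal) ⁻¹' Set.Iic x =
        ∅ := by
      ext m
      simp only [Set.mem_preimage, Set.mem_Iic, Set.mem_empty_iff_false, iff_false, not_le]
      exact (not_le.1 hx).trans_le ENNReal.toReal_nonneg
    rw [this]; simp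

lemma lintegral_expMeasure_pow {r b : ℝ} (hr : 0 < r) (hb : 0 ≤ b) (k : ℕ) :
    ∫⁻ t, ENNReal.ofReal (t ^ k * Real.exp (-(b * t))) ∂expMeasure r =
      ENNReal.ofReal (r * k.factorial / (r + b) ^ (k + 1)) := by
  have hrb : 0 < r + b := by linarith
  have hint := Real.integral_rpow_mul_exp_neg_mul_Ioi (a := k + 1) (by positivity) hrb
  have hI := Real.Gamma_nat_eq_factorial k
  have hI' : IntegrableOn (fun t : ℝ => r * (t ^ k * Real.exp (-((r + b) * t)))) (Set.Ioi 0) := by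
    refine Integrable.const_mul ?_ r
    -- A non-integrable function has integral `0` by default, contradicting the positive Gamma
    -- value.
    by_contra hni
    have h0 := integral_undef hni
    have : (∫ t in Set.Ioi (0 : ℝ), t ^ ((k : ℝ) + 1 - 1) * Real.exp (-((r + b) * t))) = 0 := by
      refine Eq.trans (setIntegral_congr_fun measurableSet_Ioi fun t _ => ?_) h0
      simp
    rw [this, hI] at hint
    have : 0 < (1 / (r + b)) ^ ((k : ℝ) + 1) * k.factorial := by positivity
    linarith
  rw [expMeasure, gammaMeasure, lintegral_withDensity_eq_lintegral_mul _ (by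
    exact (measurable_gammaPDFReal 1 r).ennreal_ofReal) (by fun_prop)]
  have e : ∀ t : ℝ, (gammaPDF 1 r * fun t => ENNReal.ofReal (t ^ k * Real.exp (-(b * t)))) t =
      (Set.Ici 0).indicator
        (fun t => ENNReal.ofReal (r * (t ^ k * Real.exp (-((r + b) * t))))) t := by
    intro t
    by_cases ht : 0 ≤ t
    · rw [Set.indicator_of_mem (by exact ht), Pi.mul_apply, gammaPDF_of_nonneg ht,
        ← ENNReal.ofReal_mul (by simp; positivity)]
      congr 1
      have : Real.exp (-((r + b) * t)) = Real.exp (-(r * t)) * Real.exp (-(b * t)) := by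
        rw [← Real.exp_add]; ring_nf
      rw [this]
      simp
      ring
    · rw [Set.indicator_of_notMem (by exact ht), Pi.mul_apply, gammaPDF_of_neg (not_le.1 ht),
        zero_mul]
  simp_rw [e]
  rw [lintegral_indicator (measurableSet_Ici (a := (0 : ℝ))), setLIntegral_congr Ioi_ae_eq_Ici.symm,
    ← ofReal_integral_eq_lintegral_ofReal hI' ?_]
  · congr 1
    rw [integral_const_mul]
    have e3 : (∫ t in Set.Ioi (0 : ℝ), t ^ k * Real.exp (-((r + b) * t))) =
        ∫ t in Set.Ioi (0 : ℝ), t ^ ((k : ℝ) + 1 - 1) * Real.exp (-((r + b) * t)) := by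
      refine setIntegral_congr_fun measurableSet_Ioi fun t _ => ?_
      simp
    rw [e3, hint, hI]
    have : (1 / (r + b)) ^ ((k : ℝ) + 1) = 1 / (r + b) ^ (k + 1) := by
      rw [← Nat.cast_succ, Real.rpow_natCast, one_div_pow]
    rw [this]
    ring
  · filter_upwards [ae_restrict_mem measurableSet_Ioi] with t ht
    have : (0 : ℝ) < t := ht
    simp only [Pi.zero_apply]
    positivity

lemma IsPoissonLaw.lintegral_voidRegion_true (hd : 1 ≤ d) (hc : c ≠ 0)
    (h : IsPoissonLaw ρ (c • volume)) {b : ℝ} (hb : 0 ≤ b) (k : ℕ) :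
    ∫⁻ m, ENNReal.ofReal ((volume (voidRegion true 0 m)).toReal ^ k *
      Real.exp (-(b * (volume (voidRegion true 0 m)).toReal))) ∂ρ =
      ENNReal.ofReal (c * k.factorial / (c + b) ^ (k + 1)) := by
  rw [← lintegral_expMeasure_pow (by positivity) hb, ← h.map_voidRegion hd hc, lintegral_map
    (by fun_prop) (measurable_volume_voidRegion_right true 0).ennreal_toReal]

/-- The mean volumes of the two void regions agree. -/
lemma IsPoissonLaw.lintegral_volume_voidRegion (h : IsPoissonLaw ρ (c • volume)) (out : Bool) :
    ∫⁻ m, volume (voidRegion out 0 m) ∂ρ =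
      ∫⁻ y, ENNReal.ofReal
        (Real.exp (-(c * (volume (Metric.ball (0 : Space d) ‖y‖)).toReal)))
        ∂(volume : Measure (Space d)) := by
  have := h.prob
  have hmeas : MeasurableSet {p : Measure (Space d) × Space d | p.2 ∈ voidRegion out 0 p.1} :=
    ((measurable_const (a := (0 : Space d))).prodMk measurable_fst |>.prodMk measurable_snd)
      (measurableSet_voidRegion_graph out)
  -- Fubini: the mean volume integrates the probability that `y` is in the region, a void
  -- probability depending on the radius `‖y‖` but not on the centre.
  have e1 := Measure.prod_apply (μ := ρ) (ν := (volume : Measure (Space d))) hmeas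
  have e2 := Measure.prod_apply_symm (μ := ρ) (ν := (volume : Measure (Space d))) hmeas
  refine e1.symm.trans (e2.trans (lintegral_congr fun y => ?_))
  refine Eq.trans ?_ (h.void_ball (bif out then 0 else y) ‖y‖)
  congr 1
  ext m
  change m (Metric.ball _ ‖0 - y‖) = 0 ↔ _
  rw [zero_sub, norm_neg]
  rfl

/-- Only the out-region has an explicit law; the mean `1 / c` of its exponential volume transfers to
the in-region. -/
lemma IsPoissonLaw.lintegral_volume_voidRegion_eq (hd : 1 ≤ d) (hc : c ≠ 0)
    (h : IsPoissonLaw ρ (c • volume)) (out : Bool) :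
    ∫⁻ m, volume (voidRegion out 0 m) ∂ρ = ENNReal.ofReal (1 / c) := by
  rw [h.lintegral_volume_voidRegion out, ← h.lintegral_volume_voidRegion true]
  have e := h.lintegral_voidRegion_true hd hc le_rfl 1
  have e2 : ∫⁻ m, volume (voidRegion true 0 m) ∂ρ = ∫⁻ m, ENNReal.ofReal
      ((volume (voidRegion true 0 m)).toReal ^ 1 *
        Real.exp (-(0 * (volume (voidRegion true 0 m)).toReal))) ∂ρ := by
    refine lintegral_congr_ae ?_
    filter_upwards [h.ae_volume_voidRegion_true_ne_top hd hc] with m hm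
    simp [ENNReal.ofReal_toReal hm]
  rw [e2, e]
  congr 1
  have : (c : ℝ) ≠ 0 := by simpa using hc
  simp
  field_simp

lemma IsPoissonLaw.ae_volume_voidRegion_ne_top (hd : 1 ≤ d) (hc : c ≠ 0)
    (h : IsPoissonLaw ρ (c • volume)) (out : Bool) (x : Space d) :
    ∀ᵐ m ∂ρ, volume (voidRegion out x m) ≠ ∞ := by
  have e : ∫⁻ m, volume (voidRegion out x m) ∂ρ ≠ ∞ := by
    exact ((h.lintegral_voidRegion out x measurable_id).trans
      (h.lintegral_volume_voidRegion_eq hd hc out)).trans_ne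
      ENNReal.ofReal_ne_top
  filter_upwards [ae_lt_top (measurable_volume_voidRegion_right out x) e] with m hm using hm.ne

end Regions

/-! ### Degrees of the secrecy graph and Voronoi cells as void regions -/

section Typical

variable {d : ℕ}

lemma pointMeasure_null_iff (X : Set (Space d)) {B : Set (Space d)} (hB : MeasurableSet B) :
    pointMeasure X B = 0 ↔ ∀ z ∈ X, z ∉ B := by
  rw [pointMeasure_apply _ hB]
  simp [Set.eq_empty_iff_forall_notMem]

/-- The out-neighbours or the in-neighbours of a vertex. -/
def neighbours {V : Type*} (out : Bool) (G : Digraph V) (x : V) : Set V :=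
  bif out then outNeighbours G x else inNeighbours G x

lemma neighbours_secrecyGraph (out : Bool) {P R : Set (Space d)} {x : Space d} (hx : x ∈ P) :
    neighbours out (secrecyGraph P R) x = P ∩ (voidRegion out x (pointMeasure R) \ {x}) := by
  ext y
  have hv : y ∈ voidRegion out x (pointMeasure R) ↔
      ∀ z ∈ R, z ∉ Metric.ball (bif out then x else y) ‖x - y‖ :=
    pointMeasure_null_iff R Metric.isOpen_ball.measurableSet
  cases out
  · change (y ∈ P ∧ x ∈ P ∧ y ≠ x ∧ ∀ z ∈ R, z ∉ Metric.ball y ‖y - x‖) ↔ _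
    rw [Set.mem_inter_iff, Set.mem_sdiff, hv, norm_sub_rev y x]
    simp only [cond_false, Set.mem_singleton_iff]
    tauto
  · change (x ∈ P ∧ y ∈ P ∧ x ≠ y ∧ ∀ z ∈ R, z ∉ Metric.ball x ‖x - y‖) ↔ _
    rw [Set.mem_inter_iff, Set.mem_sdiff, hv, ne_comm]
    simp only [cond_true, Set.mem_singleton_iff]
    tauto

lemma encard_neighbours (out : Bool) {P R : Set (Space d)} {x : Space d} (hx : x ∈ P) :
    ((neighbours out (secrecyGraph P R) x).encard : ℝ≥0∞) =
      pointMeasure P (voidRegion out x (pointMeasure R) \ {x}) := by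
  rw [neighbours_secrecyGraph out hx, pointMeasure_apply _
    ((measurableSet_voidRegion out x _).diff (measurableSet_singleton x))]

/-- No nucleus is strictly closer to `z` than `x` is exactly when the open ball about `z` with `x`
on its boundary is void. This links indegrees to Voronoi cells. -/
lemma voronoiCell_eq (Q : Set (Space d)) (x : Space d) :
    voronoiCell Q x = voidRegion false x (pointMeasure Q) := by
  ext z
  refine Iff.trans ?_ (pointMeasure_null_iff Q Metric.isOpen_ball.measurableSet).symm
  refine forall₂_congr fun y _ => ?_
  rw [cond_false, Metric.mem_ball, dist_comm, dist_eq_norm, norm_sub_rev x z, not_lt]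

/-- The point `x` lies on the boundary of each open test ball, so the point added by the Mecke
equation does not change the cell. -/
lemma voidRegion_add_dirac (x : Space d) (m : Measure (Space d)) :
    voidRegion false x (m + Measure.dirac x) = voidRegion false x m := by
  ext y
  have : Measure.dirac x (Metric.ball y ‖x - y‖) = 0 := by
    rw [Measure.dirac_apply' _ Metric.isOpen_ball.measurableSet]
    simp [dist_eq_norm]
  change (m + Measure.dirac x) (Metric.ball y ‖x - y‖) = 0 ↔ m (Metric.ball y ‖x - y‖) = 0
  rw [Measure.add_apply, this, add_zero]

lemma measurable_lintegral_poissonENN {h : ℝ≥0∞ → ℝ≥0∞} (hh : Measurable h) :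
    Measurable fun a => ∫⁻ n, h n ∂poissonENN a := by
  simp_rw [lintegral_poissonENN _ hh]
  fun_prop

lemma measurable_kernel_voidRegion {κ : Kernel (Measure (Space d)) (Space d)} [IsSFiniteKernel κ]
    (out : Bool) :
    Measurable fun p : Space d × Measure (Space d) × Measure (Space d) =>
      κ p.2.1 (voidRegion out p.1 p.2.2 \ {p.1}) := by
  have h1 : MeasurableSet {q : (Space d × Measure (Space d) × Measure (Space d)) × Space d |
      q.2 ∈ voidRegion out q.1.1 q.1.2.2} :=
    ((measurable_fst.fst.prodMk measurable_fst.snd.snd).prodMk measurable_snd)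
      (measurableSet_voidRegion_graph out)
  have h2 : MeasurableSet {q : (Space d × Measure (Space d) × Measure (Space d)) × Space d |
      q.2 = q.1.1} := measurableSet_eq_fun measurable_snd measurable_fst.fst
  exact Kernel.measurable_kernel_prodMk_left
    (κ := κ.comap (fun p : Space d × Measure (Space d) × Measure (Space d) => p.2.1)
      measurable_snd.fst) (h1.diff h2)

/-- The Palm mean of a function of the degree of a vertex. -/
lemma lintegral_degree (hd : 1 ≤ d) {c : ℝ≥0} (hc : c ≠ 0) {ρ ρ' : Measure (Measure (Space d))}
    (hρ : IsPoissonLaw ρ ((1 : ℝ≥0) • volume)) (hρ' : IsPoissonLaw ρ' (c • volume))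
    {κ : Kernel (Measure (Space d)) (Space d)}
    (hκ : ∀ m : Measure (Space d),
      (∀ n, m (spanningSets ((1 : ℝ≥0) • (volume : Measure (Space d))) n) ≠ ∞) → κ m = m)
    (out : Bool) {h : ℝ≥0∞ → ℝ≥0∞} (hh : Measurable h) (x : Space d) :
    ∫⁻ y, ∫⁻ m, h (κ (m + Measure.dirac x) (voidRegion out x y \ {x})) ∂ρ ∂ρ' =
      ∫⁻ y, ∫⁻ n, h n ∂poissonENN (volume (voidRegion out 0 y)) ∂ρ' := by
  -- Positive dimension makes singletons null, so removing `x` from the region costs no volume.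
  have : Nonempty (Fin d) := ⟨⟨0, hd⟩⟩
  rw [← hρ'.lintegral_voidRegion out x (measurable_lintegral_poissonENN hh)]
  refine lintegral_congr_ae ?_
  filter_upwards [hρ'.ae_volume_voidRegion_ne_top hd hc out x] with y hy
  have hA := (measurableSet_voidRegion out x y).diff (measurableSet_singleton x)
  have hvol : ((1 : ℝ≥0) • (volume : Measure (Space d))) (voidRegion out x y \ {x}) =
      volume (voidRegion out x y) := by
    rw [one_smul, measure_sdiff_null (by simp)]
  have e := hρ.lintegral_comp_count hA (by rwa [hvol]) hh
  rw [hvol] at e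
  rw [← e]
  refine lintegral_congr_ae ?_
  filter_upwards [hρ.ae_spanningSets] with m hm
  -- The added point is `x` itself, which the region excludes, so the count is that of the original
  -- process.
  rw [hκ (m + Measure.dirac x) fun n => ?_, Measure.add_apply, Measure.dirac_apply' _ hA]
  · simp
  · exact ENNReal.add_ne_top.2 ⟨hm n, measure_ne_top _ _⟩

section Degrees

variable {Ω : Type*} [MeasurableSpace Ω] {μ : Measure Ω} [IsProbabilityMeasure μ]
  {P R : Ω → Set (Space d)} {c : ℝ≥0}

/-- The mean of a function of the degree of a typical vertex of the secrecy graph. -/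
lemma typicalMean_degree (hd : 1 ≤ d) (hc : c ≠ 0) (hP : IsPoissonProcess μ P 1)
    (hR : IsPoissonProcess μ R c) (hPR : IndepProcesses μ P R) {W : Set (Space d)}
    (hW : MeasurableSet W) (hW0 : volume W ≠ 0) (hW1 : volume W ≠ ∞) (out : Bool)
    {h : ℝ≥0∞ → ℝ≥0∞} (hh : Measurable h) {f : Ω → Space d → ℝ≥0∞}
    (hf : ∀ ω x, f ω x = h (neighbours out (secrecyGraph (P ω) (R ω)) x).encard) :
    typicalMean μ P W f = ∫⁻ m, ∫⁻ n, h n ∂poissonENN (volume (voidRegion out 0 m))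
      ∂μ.map fun ω => pointMeasure (R ω) := by
  have hρ := hP.isPoissonLaw one_ne_zero
  have hρ' := hR.isPoissonLaw hc
  obtain ⟨κ, hκs, hκ⟩ := exists_sFinite_kernel ((1 : ℝ≥0) • (volume : Measure (Space d)))
  have hκ' : ∀ᵐ m ∂μ.map fun ω => pointMeasure (P ω), κ m = m :=
    hρ.ae_spanningSets.mono hκ
  refine hP.typicalMean_eq one_ne_zero hR.measurable_pointMeasure hPR.indepFun hκ' hW hW0 hW1
    (G := fun x m y => h (κ m (voidRegion out x y \ {x})))
    (hh.comp (measurable_kernel_voidRegion out)) ?_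
    (lintegral_degree hd hc hρ hρ' hκ out hh)
  filter_upwards [ae_of_ae_map hP.measurable_pointMeasure.aemeasurable hκ'] with ω hω x hx
  rw [hf, hω, encard_neighbours out hx]

lemma poissonENN_top (a : ℝ≥0∞) : poissonENN a {∞} = 0 := by
  rw [poissonENN, Measure.map_apply Measurable.of_discrete (measurableSet_singleton _)]
  convert measure_empty (μ := poissonMeasure a.toNNReal)
  ext n
  simp

/-- Almost surely, all vertices of the secrecy graph have finite degrees. -/
lemma ae_finite_neighbours (hd : 1 ≤ d) (hc : c ≠ 0) (hP : IsPoissonProcess μ P 1)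
    (hR : IsPoissonProcess μ R c) (hPR : IndepProcesses μ P R) (out : Bool) :
    ∀ᵐ ω ∂μ, ∀ x ∈ P ω, (neighbours out (secrecyGraph (P ω) (R ω)) x).Finite := by
  have hρ := hP.isPoissonLaw one_ne_zero
  have hρ' := hR.isPoissonLaw hc
  obtain ⟨κ, hκs, hκ⟩ := exists_sFinite_kernel ((1 : ℝ≥0) • (volume : Measure (Space d)))
  have hκ' : ∀ᵐ m ∂μ.map fun ω => pointMeasure (P ω), κ m = m :=
    hρ.ae_spanningSets.mono hκ
  -- The test function detects infinite degrees, to which a Poisson law gives no mass.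
  have hh : Measurable (Set.indicator {∞} (1 : ℝ≥0∞ → ℝ≥0∞)) :=
    measurable_one.indicator (measurableSet_singleton _)
  have key := hP.ae_forall_eq_zero one_ne_zero hR.measurable_pointMeasure hPR.indepFun hκ'
    (G := fun x m y => Set.indicator {∞} 1 (κ m (voidRegion out x y \ {x})))
    (f := fun ω x => Set.indicator {∞} 1
      ((neighbours out (secrecyGraph (P ω) (R ω)) x).encard : ℝ≥0∞))
    (hh.comp (measurable_kernel_voidRegion out)) (by
      filter_upwards [ae_of_ae_map hP.measurable_pointMeasure.aemeasurable hκ'] with ω hω x hx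
      rw [hω, encard_neighbours out hx])
    (fun x => by
      rw [lintegral_degree hd hc hρ hρ' hκ out hh]
      simp_rw [lintegral_indicator_one (measurableSet_singleton ∞), poissonENN_top, lintegral_zero])
  filter_upwards [key] with ω hω x hx
  rw [← Set.encard_ne_top_iff]
  intro ht
  simpa [ht] using hω x hx

end Degrees

section Cells

variable {Ω : Type*} [MeasurableSpace Ω] {ν : Measure Ω} [IsProbabilityMeasure ν]
  {Q : Ω → Set (Space d)} {c : ℝ≥0}

/-- The mean of a function of the volume of the typical cell. -/
lemma typicalMean_cell (hc : c ≠ 0) (hQ : IsPoissonProcess ν Q c) {W : Set (Space d)}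
    (hW : MeasurableSet W) (hW0 : volume W ≠ 0) (hW1 : volume W ≠ ∞)
    {g : ℝ≥0∞ → ℝ≥0∞} (hg : Measurable g) {f : Ω → Space d → ℝ≥0∞}
    (hf : ∀ ω x, f ω x = g (volume (voronoiCell (Q ω) x))) :
    typicalMean ν Q W f =
      ∫⁻ m, g (volume (voidRegion false 0 m)) ∂ν.map fun ω => pointMeasure (Q ω) := by
  have hρ := hQ.isPoissonLaw hc
  obtain ⟨κ, hκs, hκ⟩ := exists_sFinite_kernel (c • (volume : Measure (Space d)))
  have : IsProbabilityMeasure (ν.map fun _ => ()) :=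
    Measure.isProbabilityMeasure_map measurable_const.aemeasurable
  -- A cell depends on `Q` alone, so the independent random element is taken to be trivial.
  refine hQ.typicalMean_eq hc (measurable_const (a := ())) (indepFun_const_right _ _)
    (hρ.ae_spanningSets.mono hκ) hW hW0 hW1
    (G := fun x m _ => g (volume (voidRegion false x m))) ?_ (ae_of_all _ fun ω x _ => ?_) fun x => ?_
  · exact hg.comp ((measurable_volume_voidRegion false).comp
      (measurable_fst.prodMk measurable_snd.fst))
  · rw [hf, voronoiCell_eq]
  · simp_rw [voidRegion_add_dirac, hρ.lintegral_voidRegion false x hg]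
    simp

/-- Almost surely, all cells of the Poisson-Voronoi tessellation have finite volume. -/
lemma ae_volume_voronoiCell_ne_top (hd : 1 ≤ d) (hc : c ≠ 0) (hQ : IsPoissonProcess ν Q c) :
    ∀ᵐ ω ∂ν, ∀ x ∈ Q ω, volume (voronoiCell (Q ω) x) ≠ ∞ := by
  have hρ := hQ.isPoissonLaw hc
  obtain ⟨κ, hκs, hκ⟩ := exists_sFinite_kernel (c • (volume : Measure (Space d)))
  have hg : Measurable (Set.indicator {∞} (1 : ℝ≥0∞ → ℝ≥0∞)) :=
    measurable_one.indicator (measurableSet_singleton _)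
  have key := hQ.ae_forall_eq_zero hc (measurable_const (a := ())) (indepFun_const_right _ _)
    (hρ.ae_spanningSets.mono hκ)
    (G := fun x m _ => Set.indicator {∞} 1 (volume (voidRegion false x m)))
    (f := fun ω x => Set.indicator {∞} 1 (volume (voronoiCell (Q ω) x)))
    (hg.comp ((measurable_volume_voidRegion false).comp
      (measurable_fst.prodMk measurable_snd.fst)))
    (ae_of_all _ fun ω x _ => by rw [voronoiCell_eq])
    (fun x => by
      have : ∫⁻ m, Set.indicator {∞} (1 : ℝ≥0∞ → ℝ≥0∞) (volume (voidRegion false x m))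
          ∂ν.map (fun ω => pointMeasure (Q ω)) = 0 := by
        rw [← lintegral_zero (μ := ν.map fun ω => pointMeasure (Q ω))]
        refine lintegral_congr_ae ?_
        filter_upwards [hρ.ae_volume_voidRegion_ne_top hd hc false x] with m hm
        simp [hm]
      simp_rw [voidRegion_add_dirac, this, lintegral_zero])
  filter_upwards [key] with ω hω x hx ht
  simpa [ht] using hω x hx

end Cells

end Typical

/-! ### Integrals of Poisson weights -/

section Mixtures

lemma lintegral_poissonENN_singleton (a : ℝ≥0∞) (k : ℕ) :
    ∫⁻ n, Set.indicator {(k : ℝ≥0∞)} 1 n ∂poissonENN a =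
      ENNReal.ofReal (Real.exp (-a.toReal) * a.toReal ^ k / k.factorial) := by
  rw [lintegral_poissonENN a (measurable_one.indicator (measurableSet_singleton _)),
    tsum_eq_single k]
  · simp
  · intro n hn
    simp [hn]

lemma lintegral_poissonENN_id {a : ℝ≥0∞} (ha : a ≠ ∞) : ∫⁻ n, n ∂poissonENN a = a := by
  simpa using lintegral_poissonENN_mul ha (f := fun _ => 1) measurable_const

lemma lintegral_poissonENN_exp (a : ℝ≥0∞) (t : ℝ) :
    ∫⁻ n, ENNReal.ofReal (Real.exp (t * n.toReal)) ∂poissonENN a =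
      ENNReal.ofReal (Real.exp (a.toReal * (Real.exp t - 1))) := by
  rw [lintegral_poissonENN a (by fun_prop)]
  set b := a.toReal with hb
  have hb0 : 0 ≤ b := ENNReal.toReal_nonneg
  have hsum : HasSum (fun n : ℕ => Real.exp (-b) * ((b * Real.exp t) ^ n / n.factorial))
      (Real.exp (-b) * Real.exp (b * Real.exp t)) := by
    rw [Real.exp_eq_exp_ℝ]
    exact (NormedSpace.expSeries_div_hasSum_exp (b * _)).mul_left _
  have e : Real.exp (b * (Real.exp t - 1)) = Real.exp (-b) * Real.exp (b * Real.exp t) := by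
    rw [← Real.exp_add]; ring_nf
  rw [e, ← hsum.tsum_eq, ENNReal.ofReal_tsum_of_nonneg (fun n => by positivity) hsum.summable]
  refine tsum_congr fun n => ?_
  rw [← ENNReal.ofReal_mul (by positivity)]
  congr 1
  rw [ENNReal.toReal_natCast, mul_pow, ← Real.exp_nat_mul, mul_comm t]
  ring

lemma poisson_weight_le_one {u : ℝ} (hu : 0 ≤ u) (k : ℕ) :
    1 / (k.factorial : ℝ) * (Real.exp (-u) * u ^ k) ≤ 1 := by
  have h := Real.pow_div_factorial_le_exp u hu k
  calc _ = Real.exp (-u) * (u ^ k / k.factorial) := by ring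
    _ ≤ Real.exp (-u) * Real.exp u := by gcongr
    _ = 1 := by rw [← Real.exp_add]; simp

/-- The weights lie in `[0, 1]` only for `s ≥ 0`, so `η` is first restricted to `Set.Ioi 0`. There
`f` dominates the integrand, which allows the passage to a Bochner integral. -/
lemma lintegral_withDensity_poisson_weight {η : Measure ℝ} [IsProbabilityMeasure η] {f : ℝ → ℝ}
    (hf : Measurable f) (hf0 : ∀ s, 0 ≤ f s)
    (hη : η = volume.withDensity fun s => ENNReal.ofReal (f s))
    (hpos : η (Set.Iio 0) = 0) {lam : ℝ≥0} (k : ℕ) :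
    ∫⁻ s, ENNReal.ofReal (1 / (k.factorial : ℝ) * (Real.exp (-s / lam) * (s / lam) ^ k)) ∂η =
      ENNReal.ofReal (1 / (k.factorial : ℝ) *
        ∫ s in Set.Ioi (0 : ℝ), f s * Real.exp (-s / lam) * (s / lam) ^ k) := by
  have hfm : Measurable fun s => ENNReal.ofReal (f s) := hf.ennreal_ofReal
  have hae : ∀ᵐ s ∂η, s ∈ Set.Ioi (0 : ℝ) := by
    have h0 : η {0} = 0 := by
      rw [hη, withDensity_apply _ (measurableSet_singleton 0)]
      exact setLIntegral_measure_zero _ _ Real.volume_singleton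
    have : (Set.Ioi (0 : ℝ))ᶜ = Set.Iio 0 ∪ {0} := by ext; simp [le_iff_lt_or_eq]
    change η (Set.Ioi (0 : ℝ))ᶜ = 0
    rw [this]
    exact measure_union_null hpos h0
  have hw : ∀ s ∈ Set.Ioi (0 : ℝ),
      1 / (k.factorial : ℝ) * (Real.exp (-s / lam) * (s / lam) ^ k) ≤ 1 := by
    intro s hs
    have : 0 ≤ s / lam := div_nonneg (le_of_lt hs) lam.2
    simpa [neg_div] using poisson_weight_le_one this k
  have hfint : ∫⁻ s, ENNReal.ofReal (f s) = 1 := by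
    have := measure_univ (μ := η)
    rwa [hη, withDensity_apply _ MeasurableSet.univ, Measure.restrict_univ] at this
  have hnn : ∀ s ∈ Set.Ioi (0 : ℝ),
      0 ≤ 1 / (k.factorial : ℝ) * (f s * Real.exp (-s / lam) * (s / lam) ^ k) := by
    intro s hs
    have h1 : 0 ≤ s / lam := div_nonneg (le_of_lt hs) lam.2
    have := hf0 s
    positivity
  have hint : IntegrableOn
      (fun s => 1 / (k.factorial : ℝ) * (f s * Real.exp (-s / lam) * (s / lam) ^ k))
      (Set.Ioi 0) := by
    refine Integrable.mono' (g := f) ?_ (by fun_prop) ?_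
    · refine Integrable.integrableOn ⟨hf.aestronglyMeasurable, ?_⟩
      rw [hasFiniteIntegral_iff_ofReal (ae_of_all _ hf0), hfint]
      exact ENNReal.one_lt_top
    · filter_upwards [ae_restrict_mem measurableSet_Ioi] with s hs
      rw [Real.norm_of_nonneg (hnn s hs)]
      calc _ = f s * (1 / (k.factorial : ℝ) * (Real.exp (-s / lam) * (s / lam) ^ k)) := by ring
        _ ≤ f s * 1 := mul_le_mul_of_nonneg_left (hw s hs) (hf0 s)
        _ = f s := mul_one _
  rw [← integral_const_mul, ofReal_integral_eq_lintegral_ofReal hint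
    ((ae_restrict_mem measurableSet_Ioi).mono hnn), ← Measure.restrict_eq_self_of_ae_mem hae]
  nth_rw 1 [hη]
  rw [setLIntegral_withDensity_eq_setLIntegral_mul _ hfm (by fun_prop) measurableSet_Ioi]
  refine lintegral_congr fun s => ?_
  rw [Pi.mul_apply, ← ENNReal.ofReal_mul (hf0 s)]
  congr 1
  ring

/-- For infinite sets both sides take the default value `0`. -/
lemma toReal_encard {α : Type*} (s : Set α) : (s.encard : ℝ≥0∞).toReal = s.ncard := by
  obtain hs | hs := s.finite_or_infinite
  · rw [← hs.cast_ncard_eq]; simp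
  · simp [hs.encard_eq, hs.ncard]

end Mixtures

/-! ### The degree laws -/

theorem theorem1 {d : ℕ} (hd : 1 ≤ d) (lam : ℝ≥0) (hlam : 0 < lam)
    -- the black points `P` and the red points `R`
    {Ω : Type*} [MeasurableSpace Ω] (μ : Measure Ω) [IsProbabilityMeasure μ]
    (P R : Ω → Set (Space d)) (hP : IsPoissonProcess μ P 1) (hR : IsPoissonProcess μ R lam)
    (hPR : IndepProcesses μ P R)
    -- the nuclei `Q` of the unit intensity Poisson-Voronoi tessellation
    {Ω' : Type*} [MeasurableSpace Ω'] (ν : Measure Ω') [IsProbabilityMeasure ν]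
    (Q : Ω' → Set (Space d)) (hQ : IsPoissonProcess ν Q 1)
    -- arbitrary observation windows for the typical vertex and the typical cell
    (W : Set (Space d)) (hW : MeasurableSet W) (hW0 : volume W ≠ 0) (hW1 : volume W ≠ ∞)
    (W' : Set (Space d)) (hW' : MeasurableSet W') (hW'0 : volume W' ≠ 0) (hW'1 : volume W' ≠ ∞) :
    -- almost surely all degrees and all cell volumes are finite
    (∀ᵐ ω ∂μ, ∀ x ∈ P ω, (outNeighbours (secrecyGraph (P ω) (R ω)) x).Finite ∧
      (inNeighbours (secrecyGraph (P ω) (R ω)) x).Finite) ∧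
    (∀ᵐ ω ∂ν, ∀ x ∈ Q ω, volume (voronoiCell (Q ω) x) ≠ ∞) ∧
    -- the outdegree is geometric with mean `1 / lam`
    (∀ k : ℕ,
      typicalProb μ P W (fun ω x => (outNeighbours (secrecyGraph (P ω) (R ω)) x).encard = k) =
        ENNReal.ofReal ((1 / (1 + (lam : ℝ))) ^ k * (lam / (1 + lam)))) ∧
    typicalMean μ P W (fun ω x => (outNeighbours (secrecyGraph (P ω) (R ω)) x).encard) =
      ENNReal.ofReal (1 / lam) ∧
    -- the moment generating function of the indegree, as an identity in `[0, ∞]`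
    (∀ t : ℝ,
      typicalMean μ P W (fun ω x => ENNReal.ofReal
        (Real.exp (t * (inNeighbours (secrecyGraph (P ω) (R ω)) x).ncard))) =
      typicalMean ν Q W' (fun ω x => ENNReal.ofReal
        (Real.exp (cellVolume (Q ω) x * (Real.exp t - 1) / lam)))) ∧
    -- the distribution of the indegree as a mixture of Poisson distributions
    (∀ k : ℕ,
      typicalProb μ P W (fun ω x => (inNeighbours (secrecyGraph (P ω) (R ω)) x).encard = k) =
      typicalMean ν Q W' (fun ω x => ENNReal.ofReal
        (1 / (k.factorial : ℝ) * (Real.exp (-cellVolume (Q ω) x / lam) *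
          (cellVolume (Q ω) x / lam) ^ k)))) ∧
    -- the same in terms of the probability density function of the volume of the typical cell
    (∀ f : ℝ → ℝ, Measurable f → (∀ s, 0 ≤ f s) →
      (∀ A : Set ℝ, MeasurableSet A →
        typicalProb ν Q W' (fun ω x => cellVolume (Q ω) x ∈ A) =
          ∫⁻ s in A, ENNReal.ofReal (f s)) →
      ∀ k : ℕ,
        typicalProb μ P W (fun ω x => (inNeighbours (secrecyGraph (P ω) (R ω)) x).encard = k) =
        ENNReal.ofReal (1 / (k.factorial : ℝ) *
          ∫ s in Set.Ioi (0 : ℝ), f s * Real.exp (-s / lam) * (s / lam) ^ k)) := by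
  have hl : lam ≠ 0 := hlam.ne'
  have hρR := hR.isPoissonLaw hl
  have hρQ := hQ.isPoissonLaw one_ne_zero
  have hdeg := @typicalMean_degree d Ω _ μ _ P R lam hd hl hP hR hPR W hW hW0 hW1
  have hcell : ∀ {g : ℝ → ℝ≥0∞}, Measurable g →
      typicalMean ν Q W' (fun ω x => g (cellVolume (Q ω) x)) =
        ∫⁻ m, g (volume (voidRegion false 0 m)).toReal ∂ν.map fun ω => pointMeasure (Q ω) :=
    fun {g} hg => typicalMean_cell one_ne_zero hQ hW' hW'0 hW'1 (g := fun v => g v.toReal)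
      (hg.comp ENNReal.measurable_toReal) fun ω x => rfl
  have hprob : ∀ (out : Bool) (k : ℕ), typicalProb μ P W (fun ω x =>
      (neighbours out (secrecyGraph (P ω) (R ω)) x).encard = k) =
      ∫⁻ m, ENNReal.ofReal (Real.exp (-(volume (voidRegion out 0 m)).toReal) *
        (volume (voidRegion out 0 m)).toReal ^ k / k.factorial)
        ∂μ.map fun ω => pointMeasure (R ω) := by
    intro out k
    simp_rw [← lintegral_poissonENN_singleton]
    refine hdeg out (measurable_one.indicator (measurableSet_singleton (k : ℝ≥0∞)))
      fun ω x => ?_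
    split_ifs with h
    · simp [h]
    · rw [Set.indicator_of_notMem]
      intro h'
      have h'' : ((neighbours out (secrecyGraph (P ω) (R ω)) x).encard : ℝ≥0∞) =
        ((k : ℕ∞) : ℝ≥0∞) := by simpa using h'
      exact h (ENat.toENNReal_inj.1 h'')
  have hin : ∀ k : ℕ,
      typicalProb μ P W (fun ω x => (inNeighbours (secrecyGraph (P ω) (R ω)) x).encard = k) =
      typicalMean ν Q W' (fun ω x => ENNReal.ofReal
        (1 / (k.factorial : ℝ) * (Real.exp (-cellVolume (Q ω) x / lam) *
          (cellVolume (Q ω) x / lam) ^ k))) := by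
    intro k
    refine (hprob false k).trans ?_
    -- Scaling replaces the red process by `Q`, so the Poisson parameter becomes the cell volume
    -- divided by `lam`.
    rw [lintegral_voidRegion_intensity hd hl hρQ hρR false (g := fun v =>
      ENNReal.ofReal (Real.exp (-v.toReal) * v.toReal ^ k / k.factorial)) (by fun_prop)]
    refine Eq.trans ?_ (hcell (g := fun v => ENNReal.ofReal
      (1 / (k.factorial : ℝ) * (Real.exp (-v / lam) * (v / lam) ^ k))) (by fun_prop)).symm
    refine lintegral_congr fun m => ?_
    congr 1
    rw [ENNReal.toReal_mul, ENNReal.coe_toReal, NNReal.coe_inv, inv_mul_eq_div, neg_div]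
    ring
  refine ⟨?_, ae_volume_voronoiCell_ne_top hd one_ne_zero hQ, ?_, ?_, ?_, hin, ?_⟩
  · filter_upwards [ae_finite_neighbours hd hl hP hR hPR true,
      ae_finite_neighbours hd hl hP hR hPR false] with ω h1 h2 x hx
    exact ⟨h1 x hx, h2 x hx⟩
  · intro k
    refine (hprob true k).trans ?_
    -- Here `b = 1` is the black intensity: the Poisson weight contributes `exp (-v)` to the
    -- exponential integral, giving the denominator `(lam + 1) ^ (k + 1)`.
    have e := hρR.lintegral_voidRegion_true hd hl zero_le_one k
    have e2 : ∀ m : Measure (Space d), ENNReal.ofReal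
        (Real.exp (-(volume (voidRegion true 0 m)).toReal) *
          (volume (voidRegion true 0 m)).toReal ^ k / k.factorial) =
        ENNReal.ofReal (1 / (k.factorial : ℝ)) *
          ENNReal.ofReal ((volume (voidRegion true 0 m)).toReal ^ k *
            Real.exp (-(1 * (volume (voidRegion true 0 m)).toReal))) := by
      intro m
      rw [← ENNReal.ofReal_mul (by positivity), one_mul]
      congr 1
      ring
    simp_rw [e2]
    rw [lintegral_const_mul', e, ← ENNReal.ofReal_mul (by positivity)]
    · congr 1
      have : (k.factorial : ℝ) ≠ 0 := by positivity
      rw [one_div_pow, pow_succ, add_comm (lam : ℝ) 1]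
      field_simp
    · exact ENNReal.ofReal_ne_top
  · refine (hdeg true measurable_id fun ω x => rfl).trans ?_
    rw [← hρR.lintegral_volume_voidRegion_eq hd hl true]
    refine lintegral_congr_ae ?_
    filter_upwards [hρR.ae_volume_voidRegion_ne_top hd hl true 0] with m hm
    exact lintegral_poissonENN_id hm
  · intro t
    refine (hdeg false (h := fun n => ENNReal.ofReal (Real.exp (t * n.toReal))) (by fun_prop)
      fun ω x => by rw [toReal_encard]; rfl).trans ?_
    simp_rw [lintegral_poissonENN_exp]
    rw [lintegral_voidRegion_intensity hd hl hρQ hρR false (g := fun v =>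
      ENNReal.ofReal (Real.exp (v.toReal * (Real.exp t - 1)))) (by fun_prop)]
    refine Eq.trans ?_ (hcell (g := fun v => ENNReal.ofReal
      (Real.exp (v * (Real.exp t - 1) / lam))) (by fun_prop)).symm
    refine lintegral_congr fun m => ?_
    congr 2
    rw [ENNReal.toReal_mul, ENNReal.coe_toReal, NNReal.coe_inv]
    ring
  · intro f hf hf0 hfA k
    have := hρQ.prob
    have hV : Measurable fun m : Measure (Space d) => (volume (voidRegion false 0 m)).toReal :=
      (measurable_volume_voidRegion_right false 0).ennreal_toReal
    have hηp := Measure.isProbabilityMeasure_map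
      (μ := ν.map fun ω => pointMeasure (Q ω)) hV.aemeasurable
    -- Indicator test functions turn the assumption on `f` into the statement that the in-region
    -- volume under `Q` has density `f`.
    have hη : (ν.map fun ω => pointMeasure (Q ω)).map
        (fun m => (volume (voidRegion false 0 m)).toReal) =
        volume.withDensity fun s => ENNReal.ofReal (f s) := by
      ext A hA
      have hg : Measurable (A.indicator (1 : ℝ → ℝ≥0∞)) := measurable_one.indicator hA
      rw [withDensity_apply _ hA, ← hfA A hA, ← lintegral_indicator_one hA, lintegral_map hg hV]
      refine (hcell hg).symm.trans ?_
      congr 1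
    have hpos : (ν.map fun ω => pointMeasure (Q ω)).map
        (fun m => (volume (voidRegion false 0 m)).toReal) (Set.Iio 0) = 0 := by
      rw [Measure.map_apply hV measurableSet_Iio]
      convert measure_empty (μ := ν.map fun ω => pointMeasure (Q ω))
      ext m
      simp
    rw [hin k, ← lintegral_withDensity_poisson_weight hf hf0 hη hpos k,
      lintegral_map (by fun_prop) hV]
    exact hcell (g := fun v => ENNReal.ofReal
      (1 / (k.factorial : ℝ) * (Real.exp (-v / lam) * (v / lam) ^ k))) (by fun_prop)
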